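/- **Proposition 2.6 (liaison addition for products).** Let $k$ be a field of characteristic zero and $R=k[x_0,x_1,x_2,x_3]$. For a product $F$ of pairwise linearly independent linear forms in $R$ with at least two factors, let $J_F=\langle F_{x_0},\dots,F_{x_3}\rangle$ be its Jacobian ideal and let $\overline J_F$ be the intersection of the height two components in a minimal primary decomposition of $J_F$. Let $\overline C_F$ and $C_F^{red}$ be the curves in $\mathbb P^3$ defined by $\overline J_F$ and $\sqrt{J_F}$, respectively. For a curve $C\subset\mathbb P^3$ with ideal sheaf $\mathcal I_C$, let $M(C)=\bigoplus_{t\in\mathbb Z}H^1(\mathbb P^3,\mathcal I_C(t))$ be its Hartshorne–Rao module, a graded $R$-module. For a graded module $M$, the twist $M(a)$ is given by $M(a)_t=M_{a+t}$. Let $m,p\ge 2$, and let $F=L_1\cdots L_m$ and $G=M_1\cdots M_p$, where $L_1,\dots,L_m\in R$ are pairwise linearly independent linear forms and $M_1,\dots,M_p\in R$ are pairwise linearly independent linear forms. Assume that $G$ does not vanish on any component of $C_F^{red}$ and that $F$ does not vanish on any component of $C_G^{red}$. Then there are isomorphisms of graded $R$-modules $$M(\overline C_{FG})\cong M(\overline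 C_F)(-p)\oplus M(\overline C_G)(-m)$$ and $$M(C_{FG}^{red})\cong M(C_F^{red})(-p)\oplus M(C_G^{red})(-m).$$ -/

import Mathlib

noncomputable section

namespace ProductArrangement

open MvPolynomial

/-- The homogeneous coordinate ring `k[x₀, x₁, x₂, x₃]` of projective three-space over `k`. -/
abbrev Coord (k : Type*) [Field k] : Type _ := MvPolynomial (Fin 4) k

/-- The field of fractions of the homogeneous coordinate ring. All localizations of `Coord k` and of
its ideals are regarded as subsets of this field. -/
abbrev Frac (k : Type*) [Field k] : Type _ := FractionRing (Coord k)

/-! ### Jacobian ideals and their top-dimensional part -/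

/-- The Jacobian ideal of `F`, generated by the four first partial derivatives of `F`. -/
def jacobianIdeal {k : Type*} [Field k] (F : Coord k) : Ideal (Coord k) :=
  Ideal.span (Set.range fun i : Fin 4 => pderiv i F)

/-- `Q` is the top-dimensional part of the codimension two ideal `J`: the intersection of the
components of height two in a (minimal) primary decomposition of `J`. -/
def IsTopDimensionalPart {k : Type*} [Field k] (J Q : Ideal (Coord k)) : Prop :=
  ∃ t : Finset (Ideal (Coord k)), Submodule.IsMinimalPrimaryDecomposition J t ∧
    Q = ⨅ q ∈ {q : Ideal (Coord k) | q ∈ t ∧ q.height = 2}, q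

theorem exists_isTopDimensionalPart {k : Type*} [Field k] (J : Ideal (Coord k)) :
    ∃ Q : Ideal (Coord k), IsTopDimensionalPart J Q := by
  obtain ⟨t, ht⟩ := Submodule.IsLasker.exists_isMinimalPrimaryDecomposition (Submodule.isLasker _ _) J
  exact ⟨_, t, ht, rfl⟩

/-! ### The Hartshorne-Rao module

Let `C` be the closed subscheme of `ℙ³` defined by a homogeneous ideal `I`, so that its ideal sheaf
is the sheaf associated with `I`. The graded module `⨁ₜ H¹(ℙ³, 𝓘_C(t))` is computed by the Čech
complex of the sheaves `𝓘_C(t)` for the standard affine cover `D₊(x₀), …, D₊(x₃)`. On the open set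
`D₊(h)` the sections of `𝓘_C(t)` are the elements of degree `t` in the localization `I_h`, and the
sum of these over all integers `t` is `I_h`. -/

/-- The localization `I_h = {f / hⁿ | f ∈ I, n ≥ 0}`, inside the field of fractions. -/
def sectionsOn {k : Type*} [Field k] (I : Ideal (Coord k)) (h : Coord k) :
    Submodule (Coord k) (Frac k) where
  carrier := {g | ∃ n : ℕ, ∃ f ∈ I, algebraMap (Coord k) (Frac k) (h ^ n) * g
    = algebraMap (Coord k) (Frac k) f}
  zero_mem' := ⟨0, 0, I.zero_mem, by simp⟩
  add_mem' := by
    rintro a b ⟨n, f, hf, hn⟩ ⟨n', f', hf', hn'⟩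
    refine ⟨n + n', h ^ n' * f + h ^ n * f',
      I.add_mem (I.mul_mem_left _ hf) (I.mul_mem_left _ hf'), ?_⟩
    rw [map_add, map_mul, map_mul, ← hn, ← hn', pow_add, map_mul]
    ring
  smul_mem' := by
    rintro c a ⟨n, f, hf, hn⟩
    refine ⟨n, c * f, I.mul_mem_left _ hf, ?_⟩
    rw [map_mul, ← hn, Algebra.smul_def]
    ring

/-- The fractions that are homogeneous of degree `t`: quotients of a form of degree `d` by a nonzero
form of degree `e`, where `d - e = t`. -/
def fractionsOfDegree (k : Type*) [Field k] (t : ℤ) : Submodule k (Frac k) where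
  carrier := {g | ∃ (d e : ℕ) (a b : Coord k), a.IsHomogeneous d ∧ b.IsHomogeneous e ∧ b ≠ 0 ∧
    (d : ℤ) - e = t ∧
    algebraMap (Coord k) (Frac k) b * g = algebraMap (Coord k) (Frac k) a}
  zero_mem' := by
    refine ⟨t.toNat, (-t).toNat, 0, X 0 ^ (-t).toNat, isHomogeneous_zero _ _ _, ?_,
      pow_ne_zero _ (X_ne_zero 0), by omega, by simp⟩
    simpa using (isHomogeneous_X k (0 : Fin 4)).pow (-t).toNat
  add_mem' := by
    rintro g g' ⟨d, e, a, b, ha, hb, hb0, ht, h⟩ ⟨d', e', a', b', ha', hb', hb0', ht', h'⟩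
    refine ⟨d + e', e + e', a * b' + b * a', b * b', (ha.mul hb').add ?_, hb.mul hb',
      mul_ne_zero hb0 hb0', by push_cast; omega, ?_⟩
    · have hd : d + e' = e + d' := by omega
      rw [hd]
      exact hb.mul ha'
    · rw [map_add, map_mul, map_mul, map_mul, ← h, ← h']
      ring
  smul_mem' := by
    rintro c g ⟨d, e, a, b, ha, hb, hb0, ht, h⟩
    refine ⟨d, e, C c * a, b, ?_, hb, hb0, ht, ?_⟩
    · simpa using (isHomogeneous_C (Fin 4) c).mul ha
    · rw [map_mul, ← h, Algebra.smul_def, IsScalarTower.algebraMap_apply k (Coord k) (Frac k),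
        MvPolynomial.algebraMap_eq]
      ring

/-- Čech `0`-cochains: families `(b i)` with `b i` a section over `D₊(xᵢ)`. -/
def cochain₀ {k : Type*} [Field k] (I : Ideal (Coord k)) :
    Submodule (Coord k) (Fin 4 → Frac k) where
  carrier := {b | ∀ i, b i ∈ sectionsOn I (X i)}
  zero_mem' := fun _ => Submodule.zero_mem _
  add_mem' := fun ha hb i => Submodule.add_mem _ (ha i) (hb i)
  smul_mem' := fun c _ hb i => Submodule.smul_mem _ c (hb i)

/-- Čech `1`-cochains: families `(c i j)` with `c i j` a section over `D₊(xᵢxⱼ)`. -/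
def cochain₁ {k : Type*} [Field k] (I : Ideal (Coord k)) :
    Submodule (Coord k) (Fin 4 → Fin 4 → Frac k) where
  carrier := {c | ∀ i j, c i j ∈ sectionsOn I (X i * X j)}
  zero_mem' := fun _ _ => Submodule.zero_mem _
  add_mem' := fun ha hb i j => Submodule.add_mem _ (ha i j) (hb i j)
  smul_mem' := fun a _ hb i j => Submodule.smul_mem _ a (hb i j)

/-- The Čech differential `(δb) i j = b j - b i` on `0`-cochains. -/
def delta₀ (k : Type*) [Field k] :
    (Fin 4 → Frac k) →ₗ[Coord k] (Fin 4 → Fin 4 → Frac k) where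
  toFun b := fun i j => b j - b i
  map_add' a b := by funext i j; simp only [Pi.add_apply]; ring
  map_smul' r b := by funext i j; simp only [Pi.smul_apply, RingHom.id_apply, smul_sub]

/-- The Čech differential `(δc) i j l = c j l - c i l + c i j` on `1`-cochains. -/
def delta₁ (k : Type*) [Field k] :
    (Fin 4 → Fin 4 → Frac k) →ₗ[Coord k] (Fin 4 → Fin 4 → Fin 4 → Frac k) where
  toFun c := fun i j l => c j l - c i l + c i j
  map_add' a b := by funext i j l; simp only [Pi.add_apply]; ring
  map_smul' r b := by
    funext i j l; simp only [Pi.smul_apply, RingHom.id_apply, smul_sub, smul_add]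

/-- Čech `1`-cocycles. -/
def cocycle₁ {k : Type*} [Field k] (I : Ideal (Coord k)) :
    Submodule (Coord k) (Fin 4 → Fin 4 → Frac k) :=
  cochain₁ I ⊓ LinearMap.ker (delta₁ k)

/-- Čech `1`-coboundaries. -/
def coboundary₁ {k : Type*} [Field k] (I : Ideal (Coord k)) :
    Submodule (Coord k) (Fin 4 → Fin 4 → Frac k) :=
  (cochain₀ I).map (delta₀ k)

theorem coboundary₁_le_cocycle₁ {k : Type*} [Field k] (I : Ideal (Coord k)) :
    coboundary₁ I ≤ cocycle₁ I := by
  rintro _ ⟨b, hb, rfl⟩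
  refine ⟨fun i j => ?_, ?_⟩
  · obtain ⟨n, f, hf, hn⟩ := hb i
    obtain ⟨n', f', hf', hn'⟩ := hb j
    refine Submodule.sub_mem _ ⟨n', X i ^ n' * f', I.mul_mem_left _ hf', ?_⟩
      ⟨n, X j ^ n * f, I.mul_mem_left _ hf, ?_⟩
    · rw [map_mul, ← hn', mul_pow, map_mul]
      ring
    · rw [map_mul, ← hn, mul_pow, map_mul]
      ring
  · change delta₁ k (delta₀ k b) = 0
    funext i j l
    simp only [delta₁, delta₀, LinearMap.coe_mk, AddHom.coe_mk, Pi.zero_apply]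
    ring

/-- The Hartshorne-Rao module `M(C) = ⨁ₜ H¹(ℙ³, 𝓘_C(t))` of the closed subscheme `C` of `ℙ³` defined
by the ideal `I`: Čech `1`-cocycles modulo `1`-coboundaries. -/
abbrev HartshorneRao {k : Type*} [Field k] (I : Ideal (Coord k)) : Type _ :=
  cocycle₁ I ⧸ (coboundary₁ I).submoduleOf (cocycle₁ I)

/-- The graded piece `M(C)ₜ = H¹(ℙ³, 𝓘_C(t))`: the classes of the cocycles whose entries are all
homogeneous of degree `t`. -/
def hartshorneRaoDegree {k : Type*} [Field k] (I : Ideal (Coord k)) (t : ℤ) :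
    Submodule k (HartshorneRao I) where
  carrier := {z | ∃ c : cocycle₁ I, (∀ i j, c.1 i j ∈ fractionsOfDegree k t) ∧
    Submodule.Quotient.mk c = z}
  zero_mem' := ⟨0, fun _ _ => Submodule.zero_mem _, rfl⟩
  add_mem' := by
    rintro _ _ ⟨c, hc, rfl⟩ ⟨c', hc', rfl⟩
    exact ⟨c + c', fun i j => Submodule.add_mem _ (hc i j) (hc' i j), rfl⟩
  smul_mem' := by
    rintro a _ ⟨c, hc, rfl⟩
    exact ⟨a • c, fun i j => Submodule.smul_mem _ a (hc i j), rfl⟩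

/-! ### Graded modules: twists, direct sums, isomorphisms -/

/-- The grading of the twist `M(a)`, that is `M(a)ₜ = M_{a+t}`. -/
def twist {k M : Type*} [Field k] [AddCommGroup M] [Module k M] (gr : ℤ → Submodule k M) (a : ℤ) :
    ℤ → Submodule k M :=
  fun t => gr (a + t)

/-- The grading of the direct sum of two graded modules. -/
def sumGrading {k M N : Type*} [Field k] [AddCommGroup M] [Module k M] [AddCommGroup N] [Module k N]
    (gr : ℤ → Submodule k M) (gr' : ℤ → Submodule k N) : ℤ → Submodule k (M × N) :=
  fun t => (gr t).prod (gr' t)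

/-- Isomorphism of graded modules over the coordinate ring: an `R`-linear bijection that identifies,
for every `t`, the graded pieces of degree `t`. -/
def GradedIso {k M N : Type*} [Field k] [AddCommGroup M] [Module k M] [Module (Coord k) M]
    [AddCommGroup N] [Module k N] [Module (Coord k) N]
    (gr : ℤ → Submodule k M) (gr' : ℤ → Submodule k N) : Prop :=
  ∃ e : M ≃ₗ[Coord k] N, ∀ (t : ℤ) (x : M), x ∈ gr t ↔ e x ∈ gr' t

end ProductArrangement

end

open ProductArrangement

/-!
Put `I = G A + F B`, where `A` and `B` are either the top-dimensional parts or the radicals of the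
Jacobian ideals of `F` and `G`. As `F ∈ A` and `G ∈ B`, and as `G` and `F` are nonzerodivisors
modulo `A` and `B`, the ideal `I` is the intersection of `A`, `B` and the complete intersection
`(F, G)`. The minimal primes of the Jacobian ideal of `F G` are those of the two Jacobian ideals
together with the ideals `(Lᵢ, Mⱼ)`. Localizing at them identifies `I` with the top-dimensional
part, respectively the radical, of the Jacobian ideal of `F G`: the Jacobian ideal of a product
`a b` agrees with that of `a` wherever `b` is a unit, and `(F, G)` is the intersection of the
ideals `(Lᵢ, Mⱼ)`.

The exact sequence `0 → R(-m-p) → A(-p) ⊕ B(-m) → I → 0`, with maps `c ↦ (F c, -G c)` and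
`(a, b) ↦ G a + F b`, then gives the isomorphism of Hartshorne-Rao modules, because the structure
sheaf of `ℙ³` has no first and second cohomology in any twist.
-/

noncomputable section

namespace ProductArrangement

open MvPolynomial

section IsolatedPart

variable {R : Type*} [CommRing R] {J P : Ideal R} {f g : R}

/-- `f` lies in the localization of `J` at the prime ideal `P`. -/
def LocallyMem (J P : Ideal R) (f : R) : Prop :=
  ∃ s ∉ P, s * f ∈ J

theorem LocallyMem.mono {J' : Ideal R} (h : J ≤ J') (hf : LocallyMem J P f) :
    LocallyMem J' P f :=
  let ⟨s, hs, hsf⟩ := hf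
  ⟨s, hs, h hsf⟩

theorem locallyMem_of_mem (hP : P ≠ ⊤) (hf : f ∈ J) : LocallyMem J P f :=
  ⟨1, (Ideal.ne_top_iff_one P).mp hP, by rwa [one_mul]⟩

theorem LocallyMem.of_mul (hP : P.IsPrime) (hg : g ∉ P) (h : LocallyMem J P (g * f)) :
    LocallyMem J P f :=
  let ⟨s, hs, hsf⟩ := h
  ⟨s * g, hP.mul_notMem hs hg, by rwa [mul_assoc]⟩

theorem LocallyMem.add (hP : P.IsPrime) (hf : LocallyMem J P f) (hg : LocallyMem J P g) :
    LocallyMem J P (f + g) := by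
  obtain ⟨s, hs, hsf⟩ := hf
  obtain ⟨u, hu, hug⟩ := hg
  refine ⟨s * u, hP.mul_notMem hs hu, ?_⟩
  have : s * u * (f + g) = u * (s * f) + s * (u * g) := by ring
  rw [this]
  exact J.add_mem (J.mul_mem_left _ hsf) (J.mul_mem_left _ hug)

theorem LocallyMem.mul_left (c : R) (hf : LocallyMem J P f) : LocallyMem J P (c * f) :=
  let ⟨s, hs, hsf⟩ := hf
  ⟨s, hs, by rw [mul_left_comm]; exact J.mul_mem_left _ hsf⟩

/-- The intersection of the isolated primary components of `J`, as the ideal of the elements that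
lie in `J` locally at every minimal prime of `J`. -/
def isolatedPart (J : Ideal R) : Ideal R where
  carrier := {f | ∀ P ∈ J.minimalPrimes, LocallyMem J P f}
  zero_mem' := fun _ hP => locallyMem_of_mem hP.1.1.ne_top J.zero_mem
  add_mem' := fun hf hg P hP => (hf P hP).add hP.1.1 (hg P hP)
  smul_mem' := fun c _ hf P hP => (hf P hP).mul_left c

theorem mem_isolatedPart : f ∈ isolatedPart J ↔ ∀ P ∈ J.minimalPrimes, LocallyMem J P f :=
  Iff.rfl

theorem le_isolatedPart : J ≤ isolatedPart J :=
  fun _ hf _ hP => locallyMem_of_mem hP.1.1.ne_top hf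

theorem mem_isolatedPart_of_mul_mem (hg : ∀ P ∈ J.minimalPrimes, g ∉ P)
    (h : g * f ∈ isolatedPart J) : f ∈ isolatedPart J :=
  fun P hP => (h P hP).of_mul hP.1.1 (hg P hP)

theorem mem_radical_of_mul_mem (hg : ∀ P ∈ J.minimalPrimes, g ∉ P)
    (h : g * f ∈ J.radical) : f ∈ J.radical := by
  rw [← Ideal.sInf_minimalPrimes, Ideal.mem_sInf] at h ⊢
  exact fun {P} hP => (hP.1.1.mem_or_mem (h hP)).resolve_left (hg P hP)

theorem map_mem_isolatedPart {e : R ≃+* R} (he : ∀ f, e f ∈ J ↔ f ∈ J)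
    (hf : f ∈ isolatedPart J) : e f ∈ isolatedPart J := by
  intro P hP
  have hJ : J.comap (e : R →+* R) = J := Ideal.ext he
  have hP' : P.comap (e : R →+* R) ∈ J.minimalPrimes := by
    rw [← hJ]
    exact Ideal.minimalPrimes_comap_of_surjective e.surjective hP
  obtain ⟨s, hs, hsf⟩ := hf _ hP'
  exact ⟨e s, hs, by rw [← map_mul]; exact (he _).mpr hsf⟩

end IsolatedPart

section PrimaryDecomposition

variable {R : Type*} [CommRing R] {J P q : Ideal R} {t : Finset (Ideal R)} {f : R}

theorem height_radical (q : Ideal R) : q.radical.height = q.height := by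
  rw [Ideal.height_eq_inf_minimalPrimes, Ideal.height_eq_inf_minimalPrimes,
    Ideal.radical_minimalPrimes]

theorem le_of_mem_primaryDecomposition (ht : Submodule.IsMinimalPrimaryDecomposition J t)
    (hq : q ∈ t) : J ≤ q := by
  rw [← ht.inf_eq]
  exact Finset.inf_le (f := id) hq

theorem radical_eq_of_le_minimalPrime (ht : Submodule.IsMinimalPrimaryDecomposition J t)
    (hq : q ∈ t) (hP : P ∈ J.minimalPrimes) (hqP : q ≤ P) : q.radical = P :=
  have hle := hP.1.1.radical_le_iff.mpr hqP
  hle.antisymm (hP.2 ⟨Ideal.isPrime_radical (ht.primary hq),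
    (le_of_mem_primaryDecomposition ht hq).trans Ideal.le_radical⟩ hle)

theorem locallyMem_of_forall_component (ht : Submodule.IsMinimalPrimaryDecomposition J t)
    (hP : P.IsPrime) (hf : ∀ q ∈ t, q ≤ P → f ∈ q) : LocallyMem J P f := by
  classical
  have hs : ∀ q ∈ t, LocallyMem q P f := fun q hq => by
    by_cases hqP : q ≤ P
    · exact locallyMem_of_mem hP.ne_top (hf q hq hqP)
    · obtain ⟨s, hsq, hsP⟩ := Set.not_subset.mp hqP
      exact ⟨s, hsP, q.mul_mem_right _ hsq⟩
  choose! s hsP hsf using hs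
  refine ⟨∏ q ∈ t, s q, fun hmem => ?_, ?_⟩
  · obtain ⟨q, hq, hqs⟩ := hP.prod_mem_iff.mp hmem
    exact hsP q hq hqs
  · rw [← ht.inf_eq, Submodule.mem_finsetInf]
    intro q hq
    rw [← Finset.mul_prod_erase t s hq, mul_right_comm]
    exact Ideal.mul_mem_right _ _ (hsf q hq)

theorem mem_component_of_locallyMem_radical (ht : Submodule.IsMinimalPrimaryDecomposition J t)
    (hq : q ∈ t) (hf : LocallyMem J q.radical f) : f ∈ q := by
  obtain ⟨s, hs, hsf⟩ := hf
  have hfs : f * s ∈ q := mul_comm s f ▸ le_of_mem_primaryDecomposition ht hq hsf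
  exact ((Ideal.isPrimary_iff.mp (ht.primary hq)).2 hfs).resolve_right hs

theorem iInf_component_height_eq [IsNoetherianRing R]
    (ht : Submodule.IsMinimalPrimaryDecomposition J t) {n : ℕ∞}
    (hJ : ∀ P ∈ J.minimalPrimes, P.height = n) :
    ⨅ q ∈ {q : Ideal R | q ∈ t ∧ q.height = n}, q = isolatedPart J := by
  ext f
  simp only [Set.mem_ofPred_eq, Ideal.mem_iInf, and_imp, mem_isolatedPart]
  refine ⟨fun hf P hP => locallyMem_of_forall_component ht hP.1.1 fun q hq hqP => ?_,
    fun hf q hq hqn => mem_component_of_locallyMem_radical ht hq ?_⟩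
  · refine hf q hq ?_
    rw [← height_radical, radical_eq_of_le_minimalPrime ht hq hP hqP, hJ P hP]
  · have hprime := Ideal.isPrime_radical (ht.primary hq)
    obtain ⟨P, hP, hPq⟩ := Ideal.exists_minimalPrimes_le
      ((le_of_mem_primaryDecomposition ht hq).trans Ideal.le_radical)
    have := hP.1.1
    have hPq : P = q.radical :=
      Ideal.eq_of_le_of_height_le _ hPq (by rw [hJ P hP, height_radical, hqn])
    exact hPq ▸ hf P hP

end PrimaryDecomposition

section CompleteIntersection

variable {R : Type*} [CommRing R] {ι : Type*}

theorem mem_span_mul_pair_iff {a b c f : R}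
    (ha : ∀ u, a * u ∈ Ideal.span {c, b} → u ∈ Ideal.span {c, b}) :
    f ∈ Ideal.span {a * c, b} ↔ f ∈ Ideal.span {a, b} ∧ f ∈ Ideal.span {c, b} := by
  simp only [Ideal.mem_span_pair] at ha ⊢
  constructor
  · rintro ⟨u, v, rfl⟩
    exact ⟨⟨u * c, v, by ring⟩, u * a, v, by ring⟩
  · rintro ⟨⟨u, v, rfl⟩, x, y, h⟩
    obtain ⟨w, z, rfl⟩ := ha u ⟨x, y - v, by linear_combination h⟩
    exact ⟨w, v + a * z, by ring⟩

theorem mem_span_prod_pair_iff {a : ι → R} {b : R}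
    (ha : Pairwise fun i j => ∀ u, a i * u ∈ Ideal.span {a j, b} → u ∈ Ideal.span {a j, b})
    (s : Finset ι) (f : R) :
    f ∈ Ideal.span {∏ i ∈ s, a i, b} ↔ ∀ i ∈ s, f ∈ Ideal.span {a i, b} := by
  classical
  induction s using Finset.induction_on generalizing f with
  | empty => simp [Ideal.mem_span_pair, show ∃ x y, x + y * b = f from ⟨f, 0, by ring⟩]
  | insert i s hi ih =>
    rw [Finset.prod_insert hi, Finset.forall_mem_insert, ← ih, mem_span_mul_pair_iff]
    simp only [ih]
    exact fun u hu j hj => ha (ne_of_mem_of_not_mem hj hi).symm u (hu j hj)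

end CompleteIntersection

section LiaisonSum

variable {R : Type*} [CommRing R] {A B : Ideal R} {F G : R}

/-- The ideal `G A + F B` of the liaison addition of the ideals `A` and `B` along `F` and `G`. -/
def liaisonSum (A B : Ideal R) (F G : R) : Ideal R :=
  Ideal.span {G} * A ⊔ Ideal.span {F} * B

theorem mem_liaisonSum {f : R} :
    f ∈ liaisonSum A B F G ↔ ∃ a ∈ A, ∃ b ∈ B, G * a + F * b = f := by
  simp only [liaisonSum, Submodule.mem_sup, Ideal.mem_span_singleton_mul, exists_exists_and_eq_and]

theorem mul_mem_liaisonSum_left {a : R} (ha : a ∈ A) : G * a ∈ liaisonSum A B F G :=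
  mem_liaisonSum.mpr ⟨a, ha, 0, B.zero_mem, by ring⟩

theorem mul_mem_liaisonSum_right {b : R} (hb : b ∈ B) : F * b ∈ liaisonSum A B F G :=
  mem_liaisonSum.mpr ⟨0, A.zero_mem, b, hb, by ring⟩

theorem liaisonSum_eq_inf (hF : F ∈ A) (hG : G ∈ B) (hGA : ∀ x, G * x ∈ A → x ∈ A)
    (hFB : ∀ x, F * x ∈ B → x ∈ B) :
    liaisonSum A B F G = A ⊓ B ⊓ Ideal.span {F, G} := by
  ext f
  rw [mem_liaisonSum, Submodule.mem_inf, Submodule.mem_inf, Ideal.mem_span_pair]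
  constructor
  · rintro ⟨a, ha, b, hb, rfl⟩
    exact ⟨⟨A.add_mem (A.mul_mem_left _ ha) (A.mul_mem_right _ hF),
      B.add_mem (B.mul_mem_right _ hG) (B.mul_mem_left _ hb)⟩, b, a, by ring⟩
  · rintro ⟨⟨hA, hB⟩, b, a, rfl⟩
    refine ⟨a, hGA a ?_, b, hFB b ?_, by ring⟩
    · rw [mul_comm]
      exact (Ideal.add_mem_iff_right A (A.mul_mem_left _ hF)).mp hA
    · rw [mul_comm]
      exact (Ideal.add_mem_iff_left B (B.mul_mem_left _ hG)).mp hB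

end LiaisonSum

section LinearForms

variable {σ k : Type*} [Field k]

theorem linearMap_eq_of_isHomogeneous_one {V : Type*} [AddCommMonoid V] [Module k V]
    {f g : MvPolynomial σ k →ₗ[k] V} (h : ∀ i, f (X i) = g (X i)) {l : MvPolynomial σ k}
    (hl : l.IsHomogeneous 1) : f l = g l := by
  have hspan : l ∈ Submodule.span k (Set.range X) := by
    rwa [← homogeneousSubmodule_one_eq_span_X]
  exact LinearMap.eqOn_span (Set.forall_mem_range.mpr h) hspan

theorem exists_algHom_ker_eq_span {s : Set (MvPolynomial σ k)} (hs : ∀ l ∈ s, l.IsHomogeneous 1) :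
    ∃ φ : MvPolynomial σ k →ₐ[k] MvPolynomial σ k, RingHom.ker φ = Ideal.span s ∧
      ∀ l, l.IsHomogeneous 1 → l - φ l ∈ Submodule.span k s := by
  obtain ⟨W, hW⟩ := (Submodule.span k s).exists_isCompl
  let π : MvPolynomial σ k →ₗ[k] MvPolynomial σ k := Submodule.projection _ W hW
  let φ : MvPolynomial σ k →ₐ[k] MvPolynomial σ k := aeval fun i => X i - π (X i)
  have hπ : ∀ f, π f ∈ Submodule.span k s := Submodule.projection_apply_mem hW
  have hφ : ∀ l : MvPolynomial σ k, l.IsHomogeneous 1 → φ l = l - π l := fun l hl =>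
    eq_sub_of_add_eq (linearMap_eq_of_isHomogeneous_one (f := φ.toLinearMap + π)
      (g := LinearMap.id) (by simp [φ]) hl)
  refine ⟨φ, le_antisymm (fun f hf => ?_) (Ideal.span_le.mpr fun l hl => ?_), fun l hl => ?_⟩
  · have hmk : Ideal.Quotient.mkₐ k (Ideal.span s) = (Ideal.Quotient.mkₐ k (Ideal.span s)).comp φ :=
      algHom_ext fun i => by
        simp only [φ, AlgHom.comp_apply, aeval_X, Ideal.Quotient.mkₐ_eq_mk,
          Ideal.Quotient.mk_eq_mk_iff_sub_mem, sub_sub_cancel]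
        exact Submodule.span_le_restrictScalars k _ s (hπ _)
    have := DFunLike.congr_fun hmk f
    rwa [AlgHom.comp_apply, (RingHom.mem_ker).mp hf, map_zero, Ideal.Quotient.mkₐ_eq_mk,
      Ideal.Quotient.eq_zero_iff_mem] at this
  · change φ l = 0
    rw [hφ l (hs l hl), sub_eq_zero]
    exact (Submodule.projection_apply_of_mem_left hW (Submodule.subset_span hl)).symm
  · rw [hφ l hl, sub_sub_cancel]
    exact hπ l

theorem isPrime_span_linearForms {s : Set (MvPolynomial σ k)}
    (hs : ∀ l ∈ s, l.IsHomogeneous 1) : (Ideal.span s).IsPrime := by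
  obtain ⟨φ, hφ, -⟩ := exists_algHom_ker_eq_span hs
  rw [← hφ]
  exact RingHom.ker_isPrime _

theorem mem_ideal_span_linearForms_iff {s : Set (MvPolynomial σ k)}
    (hs : ∀ l ∈ s, l.IsHomogeneous 1) {l : MvPolynomial σ k} (hl : l.IsHomogeneous 1) :
    l ∈ Ideal.span s ↔ l ∈ Submodule.span k s := by
  refine ⟨fun h => ?_, fun h => Submodule.span_le_restrictScalars k _ s h⟩
  obtain ⟨φ, hφ, hφl⟩ := exists_algHom_ker_eq_span hs
  rw [← hφ, RingHom.mem_ker] at h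
  simpa only [h, sub_zero] using hφl l hl

theorem natCast_le_height_span_range {n : ℕ} {a : Fin n → MvPolynomial σ k}
    (ha : ∀ i, (a i).IsHomogeneous 1) (hind : LinearIndependent k a) :
    n ≤ (Ideal.span (Set.range a)).height := by
  induction n with
  | zero => simp
  | succ n ih =>
    have htail : ∀ l ∈ Set.range (Fin.tail a), l.IsHomogeneous 1 :=
      Set.forall_mem_range.mpr fun i => ha i.succ
    rw [linearIndependent_finSucc] at hind
    have hlt : Ideal.span (Set.range (Fin.tail a)) < Ideal.span (Set.range a) := by
      refine lt_of_le_not_ge (Ideal.span_mono (Set.range_comp_subset_range Fin.succ a))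
        fun hle => hind.2 ((mem_ideal_span_linearForms_iff htail (ha 0)).mp (hle ?_))
      exact Ideal.subset_span ⟨0, rfl⟩
    have := isPrime_span_linearForms htail
    have := isPrime_span_linearForms (Set.forall_mem_range.mpr ha)
    calc ((n + 1 : ℕ) : ℕ∞) ≤ (Ideal.span (Set.range (Fin.tail a))).height + 1 := by
          push_cast
          gcongr
          exact ih (fun i => ha i.succ) hind.1
      _ ≤ (Ideal.span (Set.range a)).height := Ideal.height_add_one_le_of_lt_of_isPrime hlt

theorem height_span_range_linearForms [Finite σ] {n : ℕ} {a : Fin n → MvPolynomial σ k}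
    (ha : ∀ i, (a i).IsHomogeneous 1) (hind : LinearIndependent k a) :
    (Ideal.span (Set.range a)).height = n := by
  have := isPrime_span_linearForms (Set.forall_mem_range.mpr ha)
  refine le_antisymm ?_ (natCast_le_height_span_range ha hind)
  have hle := Ideal.height_le_card_of_mem_minimalPrimes_span (Set.finite_range a)
    (Ideal.minimalPrimes_eq_subsingleton_self.ge rfl)
  rwa [Set.ncard_range_of_injective hind.injective, Nat.card_fin] at hle

theorem exists_derivation_eq_C {ι : Type*} {a : ι → MvPolynomial σ k}
    (ha : ∀ i, (a i).IsHomogeneous 1) (hind : LinearIndependent k a) (w : ι → k) :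
    ∃ D : Derivation k (MvPolynomial σ k) (MvPolynomial σ k), ∀ i, D (a i) = C (w i) := by
  obtain ⟨α, hα⟩ := LinearMap.exists_extend ((Module.Basis.span hind).constr k w)
  have hαa : ∀ i, α (a i) = w i := fun i => by
    have := LinearMap.congr_fun hα (Module.Basis.span hind i)
    rwa [Module.Basis.constr_basis, LinearMap.comp_apply, Submodule.subtype_apply,
      Module.Basis.span_apply] at this
  let D : Derivation k (MvPolynomial σ k) (MvPolynomial σ k) := mkDerivation k fun i => C (α (X i))
  have hD : ∀ l : MvPolynomial σ k, l.IsHomogeneous 1 → D l = C (α l) := fun l hl =>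
    linearMap_eq_of_isHomogeneous_one (f := D.toLinearMap)
      (g := (Algebra.linearMap k (MvPolynomial σ k)) ∘ₗ α) (fun i => by simp [D]) hl
  exact ⟨D, fun i => by rw [hD _ (ha i), hαa]⟩

variable {a b c d : MvPolynomial σ k}

theorem isPrime_span_pair (ha : a.IsHomogeneous 1) (hb : b.IsHomogeneous 1) :
    (Ideal.span {a, b}).IsPrime :=
  isPrime_span_linearForms (by simp [ha, hb])

theorem height_span_pair [Finite σ] (ha : a.IsHomogeneous 1) (hb : b.IsHomogeneous 1)
    (hind : LinearIndependent k ![a, b]) : (Ideal.span {a, b}).height = 2 := by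
  have := height_span_range_linearForms (by simp [Fin.forall_fin_two, ha, hb]) hind
  rwa [Matrix.range_cons_cons_empty] at this

theorem span_pair_eq_of_le [Finite σ] (ha : a.IsHomogeneous 1) (hb : b.IsHomogeneous 1)
    (hc : c.IsHomogeneous 1) (hd : d.IsHomogeneous 1) (hab : LinearIndependent k ![a, b])
    (hcd : LinearIndependent k ![c, d]) (hle : Ideal.span {a, b} ≤ Ideal.span {c, d}) :
    Ideal.span {a, b} = Ideal.span {c, d} :=
  have := isPrime_span_pair ha hb
  Ideal.eq_of_le_of_height_le _ hle
    (by rw [height_span_pair ha hb hab, height_span_pair hc hd hcd])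

theorem exists_derivation_eq_one_eq_zero (ha : a.IsHomogeneous 1) (hb : b.IsHomogeneous 1)
    (hind : LinearIndependent k ![a, b]) :
    ∃ D : Derivation k (MvPolynomial σ k) (MvPolynomial σ k), D a = 1 ∧ D b = 0 := by
  obtain ⟨D, hD⟩ := exists_derivation_eq_C (by simp [Fin.forall_fin_two, ha, hb]) hind ![1, 0]
  exact ⟨D, by simpa using hD 0, by simpa using hD 1⟩

end LinearForms

section HomogeneousComponent

attribute [local instance] MvPolynomial.gradedAlgebra

variable {σ R : Type*} [CommSemiring R]

theorem coe_decompose_eq_homogeneousComponent (f : MvPolynomial σ R) (d : ℕ) :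
    (DirectSum.decompose (homogeneousSubmodule σ R) f d : MvPolynomial σ R) =
      homogeneousComponent d f :=
  decomposition.decompose'_apply f d

theorem homogeneousComponent_add_mul {b : MvPolynomial σ R} {e : ℕ} (hb : b.IsHomogeneous e)
    (c : MvPolynomial σ R) (d : ℕ) :
    homogeneousComponent (e + d) (b * c) = b * homogeneousComponent d c := by
  simpa only [coe_decompose_eq_homogeneousComponent] using
    DirectSum.coe_decompose_mul_add_of_left_mem (homogeneousSubmodule σ R) (j := d) (b := c) hb

theorem homogeneousComponent_mul_of_lt {b : MvPolynomial σ R} {e d : ℕ} (hb : b.IsHomogeneous e)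
    (c : MvPolynomial σ R) (hd : d < e) : homogeneousComponent d (b * c) = 0 := by
  simpa only [coe_decompose_eq_homogeneousComponent] using
    DirectSum.coe_decompose_mul_of_left_mem_of_not_le (homogeneousSubmodule σ R) (b := c) hb
      hd.not_ge

theorem isHomogeneous_of_mul [IsCancelAdd R] [IsCancelMulZero R] {b c : MvPolynomial σ R}
    {e d : ℕ} (hb : b.IsHomogeneous e) (hb0 : b ≠ 0) (hbc : (b * c).IsHomogeneous (e + d)) :
    c.IsHomogeneous d := by
  have h := homogeneousComponent_add_mul hb c d
  rw [homogeneousComponent_eq_self hbc] at h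
  exact mul_left_cancel₀ hb0 h ▸ homogeneousComponent_isHomogeneous d c

end HomogeneousComponent

section Homogeneity

attribute [local instance] MvPolynomial.gradedAlgebra

variable {σ k : Type*} [Field k]

/-- The automorphism `xᵢ ↦ c xᵢ` of the polynomial ring. An ideal over an infinite field is
homogeneous as soon as all of these preserve it. -/
def scaling (c : kˣ) : MvPolynomial σ k ≃ₐ[k] MvPolynomial σ k :=
  AlgEquiv.ofAlgHom (aeval fun i => (c : k) • X i) (aeval fun i => (↑c⁻¹ : k) • X i)
    (by ext i : 1; simp [smul_smul]) (by ext i : 1; simp [smul_smul])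

theorem coeff_scaling (c : kˣ) (f : MvPolynomial σ k) (d : σ →₀ ℕ) :
    coeff d (scaling c f) = (c : k) ^ d.degree * coeff d f := by
  classical
  change coeff d (aeval (fun i => (c : k) • X i) f) = _
  induction f using MvPolynomial.induction_on' with
  | monomial e a =>
    rw [aeval_monomial, Finsupp.prod]
    simp only [smul_pow, Finset.prod_smul, Finset.prod_pow_eq_pow_sum]
    rw [mul_smul_comm, algebraMap_eq, ← Finsupp.prod, ← monomial_eq, coeff_smul, coeff_monomial]
    split_ifs with h
    · rw [← h, smul_eq_mul]
      rfl
    · rw [smul_zero, mul_zero]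
  | add p q hp hq => rw [map_add, coeff_add, coeff_add, hp, hq, mul_add]

theorem homogeneousComponent_scaling (c : kˣ) (f : MvPolynomial σ k) (n : ℕ) :
    homogeneousComponent n (scaling c f) = (c : k) ^ n • homogeneousComponent n f := by
  ext d
  simp only [coeff_homogeneousComponent, coeff_smul, coeff_scaling]
  split_ifs with h
  · rw [← h, smul_eq_mul]
  · rw [smul_zero]

theorem scaling_homogeneousComponent (c : kˣ) (f : MvPolynomial σ k) (n : ℕ) :
    scaling c (homogeneousComponent n f) = (c : k) ^ n • homogeneousComponent n f := by
  ext d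
  simp only [coeff_scaling, coeff_smul, coeff_homogeneousComponent]
  split_ifs with h
  · rw [h, smul_eq_mul]
  · rw [mul_zero, smul_zero]

theorem scaling_mem_iff {I : Ideal (MvPolynomial σ k)}
    (hI : I.IsHomogeneous (homogeneousSubmodule σ k)) (c : kˣ) (f : MvPolynomial σ k) :
    scaling c f ∈ I ↔ f ∈ I := by
  have hc (n : ℕ) : IsUnit ((c : k) ^ n) := c.isUnit.pow n
  rw [mem_iff_homogeneousComponent_mem hI, mem_iff_homogeneousComponent_mem hI]
  refine forall_congr' fun n => ?_
  rw [homogeneousComponent_scaling]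
  exact (I.restrictScalars k).smul_mem_iff (hc n).ne_zero

theorem isHomogeneous_of_scaling_mem [Infinite k] {I : Ideal (MvPolynomial σ k)}
    (hI : ∀ (c : kˣ), ∀ f ∈ I, scaling c f ∈ I) :
    I.IsHomogeneous (homogeneousSubmodule σ k) := by
  intro n f hf
  rw [coe_decompose_eq_homogeneousComponent]
  by_contra hn
  obtain ⟨α, hα, hIα⟩ := Submodule.exists_le_ker_of_notMem (p := I.restrictScalars k) hn
  let q : Polynomial k := ∑ i ∈ Finset.range (f.totalDegree + 1),
    Polynomial.monomial i (α (homogeneousComponent i f))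
  have hq (c : kˣ) : q.eval (c : k) = 0 := by
    have hα0 : α (scaling c f) = 0 := hIα (hI c f hf)
    rw [← sum_homogeneousComponent f, map_sum, map_sum] at hα0
    simpa [q, scaling_homogeneousComponent, Polynomial.eval_finsetSum, mul_comm] using hα0
  have hq0 : q = 0 := Polynomial.eq_zero_of_infinite_isRoot q <|
    (Set.finite_singleton (0 : k)).infinite_compl.mono fun c hc => hq (Units.mk0 c hc)
  have hcoeff : q.coeff n = α (homogeneousComponent n f) := by
    have hlt : n < f.totalDegree + 1 := by
      by_contra hlt
      exact hn (by rw [homogeneousComponent_eq_zero n f (by omega)]; exact I.zero_mem)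
    simp [q, Polynomial.coeff_monomial, hlt]
  exact hα (by rw [← hcoeff, hq0, Polynomial.coeff_zero])

theorem isHomogeneous_isolatedPart [Infinite k] {J : Ideal (MvPolynomial σ k)}
    (hJ : J.IsHomogeneous (homogeneousSubmodule σ k)) :
    (isolatedPart J).IsHomogeneous (homogeneousSubmodule σ k) :=
  isHomogeneous_of_scaling_mem fun c _ hf =>
    map_mem_isolatedPart (e := (scaling c).toRingEquiv) (scaling_mem_iff hJ c) hf

end Homogeneity

section Jacobian

attribute [local instance] MvPolynomial.gradedAlgebra

variable {k : Type*} [Field k] {F G : Coord k}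

theorem derivation_mem_jacobianIdeal (D : Derivation k (Coord k) (Coord k)) (F : Coord k) :
    D F ∈ jacobianIdeal F := by
  have hD : D = ∑ i, D (X i) • pderiv i := by
    refine derivation_ext fun j => ?_
    fin_cases j <;> simp [Fin.sum_univ_four, pderiv_X]
  have hDF : D F = ∑ i, D (X i) * pderiv i F := by
    conv_lhs => rw [hD]
    simp [Fin.sum_univ_four]
  rw [hDF]
  exact Ideal.sum_mem _ fun i _ => Ideal.mul_mem_left _ _ (Ideal.subset_span ⟨i, rfl⟩)

theorem jacobianIdeal_le_iff {I : Ideal (Coord k)} :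
    jacobianIdeal F ≤ I ↔ ∀ D : Derivation k (Coord k) (Coord k), D F ∈ I :=
  ⟨fun h D => h (derivation_mem_jacobianIdeal D F),
    fun h => Ideal.span_le.mpr (Set.range_subset_iff.mpr fun i => h (pderiv i))⟩

theorem isHomogeneous_jacobianIdeal {n : ℕ} (hF : F.IsHomogeneous n) :
    (jacobianIdeal F).IsHomogeneous (homogeneousSubmodule (Fin 4) k) :=
  Ideal.homogeneous_span _ _ <| Set.forall_mem_range.mpr fun _ => ⟨n - 1, hF.pderiv⟩

theorem self_mem_jacobianIdeal [CharZero k] {n : ℕ} (hF : F.IsHomogeneous n) (hn : n ≠ 0) :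
    F ∈ jacobianIdeal F := by
  have hEuler : (n : k) • F ∈ jacobianIdeal F := by
    rw [Nat.cast_smul_eq_nsmul, ← hF.sum_X_mul_pderiv]
    exact Ideal.sum_mem _ fun i _ => Ideal.mul_mem_left _ _ (Ideal.subset_span ⟨i, rfl⟩)
  exact (((jacobianIdeal F).restrictScalars k).smul_mem_iff (Nat.cast_ne_zero.mpr hn)).mp hEuler

theorem jacobianIdeal_mul_le (hF : F ∈ jacobianIdeal F) (G : Coord k) :
    jacobianIdeal (F * G) ≤ jacobianIdeal F := by
  rw [jacobianIdeal_le_iff]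
  intro D
  rw [Derivation.leibniz]
  exact Ideal.add_mem _ (Ideal.mul_mem_right _ _ hF)
    (Ideal.mul_mem_left _ _ (derivation_mem_jacobianIdeal D F))

theorem sq_mul_mem_jacobianIdeal_mul {f : Coord k} (hFG : F * G ∈ jacobianIdeal (F * G))
    (hf : f ∈ jacobianIdeal F) : G ^ 2 * f ∈ jacobianIdeal (F * G) := by
  have hle : jacobianIdeal F ≤
      Submodule.comap (LinearMap.mulLeft (Coord k) (G ^ 2)) (jacobianIdeal (F * G)) := by
    rw [jacobianIdeal_le_iff]
    intro D
    have hD : G ^ 2 * D F = G * D (F * G) - D G * (F * G) := by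
      rw [Derivation.leibniz, smul_eq_mul, smul_eq_mul]
      ring
    change G ^ 2 * D F ∈ jacobianIdeal (F * G)
    rw [hD]
    exact Ideal.sub_mem _ (Ideal.mul_mem_left _ _ (derivation_mem_jacobianIdeal D _))
      (Ideal.mul_mem_left _ _ hFG)
  exact hle hf

theorem locallyMem_jacobianIdeal_mul_iff {P : Ideal (Coord k)} {f : Coord k}
    (hF : F ∈ jacobianIdeal F) (hFG : F * G ∈ jacobianIdeal (F * G)) (hP : P.IsPrime)
    (hG : G ∉ P) :
    LocallyMem (jacobianIdeal (F * G)) P f ↔ LocallyMem (jacobianIdeal F) P f := by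
  refine ⟨LocallyMem.mono (jacobianIdeal_mul_le hF G), fun ⟨s, hs, hsf⟩ => ?_⟩
  exact ⟨G ^ 2 * s, hP.mul_notMem (fun h => hG (hP.mem_of_pow_mem 2 h)) hs,
    by rw [mul_assoc]; exact sq_mul_mem_jacobianIdeal_mul hFG hsf⟩

theorem jacobianIdeal_mul_of_linearIndependent {a b : Coord k} (ha : a.IsHomogeneous 1)
    (hb : b.IsHomogeneous 1) (hind : LinearIndependent k ![a, b]) :
    jacobianIdeal (a * b) = Ideal.span {a, b} := by
  refine le_antisymm (jacobianIdeal_le_iff.mpr fun D => ?_) ?_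
  · rw [Derivation.leibniz]
    exact Ideal.mem_span_pair.mpr ⟨D b, D a, by simp only [smul_eq_mul]; ring⟩
  · obtain ⟨D, hDa, hDb⟩ := exists_derivation_eq_one_eq_zero ha hb hind
    obtain ⟨E, hEb, hEa⟩ :=
      exists_derivation_eq_one_eq_zero hb ha (LinearIndependent.pair_symm_iff.mp hind)
    have hbJ : b ∈ jacobianIdeal (a * b) := by
      simpa [hDa, hDb] using derivation_mem_jacobianIdeal D (a * b)
    have haJ : a ∈ jacobianIdeal (a * b) := by
      simpa [hEa, hEb] using derivation_mem_jacobianIdeal E (a * b)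
    exact Ideal.span_le.mpr (Set.pair_subset haJ hbJ)

end Jacobian

section Arrangement

variable {k : Type*} [Field k] {ι κ : Type*}

/-- An arrangement of pairwise distinct planes in `ℙ³`, given by linear forms. -/
structure IsPlaneArrangement (L : ι → Coord k) : Prop where
  isHomogeneous : ∀ i, (L i).IsHomogeneous 1
  linearIndependent : Pairwise fun i j => LinearIndependent k ![L i, L j]

namespace IsPlaneArrangement

variable {L : ι → Coord k} {P : Ideal (Coord k)}

theorem ne_zero [Nontrivial ι] (hL : IsPlaneArrangement L) (i : ι) : L i ≠ 0 :=
  let ⟨_, hj⟩ := exists_ne i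
  (hL.linearIndependent hj.symm).ne_zero 0

theorem isPrime_span_pair (hL : IsPlaneArrangement L) (i j : ι) :
    (Ideal.span {L i, L j}).IsPrime :=
  ProductArrangement.isPrime_span_pair (hL.isHomogeneous i) (hL.isHomogeneous j)

variable [Fintype ι]

theorem isHomogeneous_prod (hL : IsPlaneArrangement L) :
    (∏ i, L i).IsHomogeneous (Fintype.card ι) := by
  simpa using IsHomogeneous.prod Finset.univ L (fun _ => 1) fun i _ => hL.isHomogeneous i

variable [CharZero k]

theorem prod_mem_jacobianIdeal [Nonempty ι] (hL : IsPlaneArrangement L) :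
    ∏ i, L i ∈ jacobianIdeal (∏ i, L i) :=
  self_mem_jacobianIdeal hL.isHomogeneous_prod Fintype.card_ne_zero

variable [Nontrivial ι]

theorem jacobianIdeal_prod_le_iff (hL : IsPlaneArrangement L) (hP : P.IsPrime) :
    jacobianIdeal (∏ i, L i) ≤ P ↔ ∃ i j, i ≠ j ∧ Ideal.span {L i, L j} ≤ P := by
  classical
  simp only [Ideal.span_le, Set.pair_subset_iff, SetLike.mem_coe]
  constructor
  · intro h
    obtain ⟨i, -, hi⟩ := hP.prod_mem_iff.mp (h hL.prod_mem_jacobianIdeal)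
    obtain ⟨j', hj'⟩ := exists_ne i
    obtain ⟨D, hD, -⟩ := exists_derivation_eq_one_eq_zero (hL.isHomogeneous i)
      (hL.isHomogeneous j') (hL.linearIndependent hj'.symm)
    have hDF := h (derivation_mem_jacobianIdeal D (∏ i, L i))
    rw [← Finset.mul_prod_erase _ L (Finset.mem_univ i), Derivation.leibniz, hD, smul_eq_mul,
      smul_eq_mul, mul_one, P.add_mem_iff_right (P.mul_mem_right _ hi)] at hDF
    obtain ⟨j, hj, hjP⟩ := hP.prod_mem_iff.mp hDF
    exact ⟨i, j, (Finset.ne_of_mem_erase hj).symm, hi, hjP⟩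
  · rintro ⟨i, j, hij, hi, hj⟩
    rw [jacobianIdeal_le_iff]
    intro D
    rw [← Finset.mul_prod_erase _ L (Finset.mem_univ i), Derivation.leibniz, smul_eq_mul,
      smul_eq_mul]
    have hj' : ∏ l ∈ Finset.univ.erase i, L l ∈ P :=
      hP.prod_mem_iff.mpr ⟨j, Finset.mem_erase.mpr ⟨hij.symm, Finset.mem_univ j⟩, hj⟩
    exact P.add_mem (P.mul_mem_right _ hi) (P.mul_mem_right _ hj')

theorem minimalPrimes_jacobianIdeal (hL : IsPlaneArrangement L) :
    (jacobianIdeal (∏ i, L i)).minimalPrimes =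
      {P | ∃ i j, i ≠ j ∧ P = Ideal.span {L i, L j}} := by
  have hJ (i j : ι) (hij : i ≠ j) : jacobianIdeal (∏ i, L i) ≤ Ideal.span {L i, L j} :=
    (hL.jacobianIdeal_prod_le_iff (hL.isPrime_span_pair i j)).mpr ⟨i, j, hij, le_rfl⟩
  ext P
  constructor
  · intro hP
    obtain ⟨i, j, hij, hle⟩ := (hL.jacobianIdeal_prod_le_iff hP.1.1).mp hP.1.2
    exact ⟨i, j, hij, (hP.2 ⟨hL.isPrime_span_pair i j, hJ i j hij⟩ hle).antisymm hle⟩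
  · rintro ⟨i, j, hij, rfl⟩
    refine ⟨⟨hL.isPrime_span_pair i j, hJ i j hij⟩, fun Q ⟨hQ, hJQ⟩ hQP => ?_⟩
    obtain ⟨i', j', hij', hle⟩ := (hL.jacobianIdeal_prod_le_iff hQ).mp hJQ
    have heq : Ideal.span {L i', L j'} = Ideal.span {L i, L j} :=
      span_pair_eq_of_le (hL.isHomogeneous i') (hL.isHomogeneous j') (hL.isHomogeneous i)
        (hL.isHomogeneous j) (hL.linearIndependent hij') (hL.linearIndependent hij)
        (hle.trans hQP)
    exact heq ▸ hle

theorem eq_isolatedPart {Q : Ideal (Coord k)} (hL : IsPlaneArrangement L)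
    (hQ : IsTopDimensionalPart (jacobianIdeal (∏ i, L i)) Q) :
    Q = isolatedPart (jacobianIdeal (∏ i, L i)) := by
  obtain ⟨t, ht, rfl⟩ := hQ
  refine iInf_component_height_eq ht fun P hP => ?_
  rw [hL.minimalPrimes_jacobianIdeal] at hP
  obtain ⟨i, j, hij, rfl⟩ := hP
  exact height_span_pair (hL.isHomogeneous i) (hL.isHomogeneous j) (hL.linearIndependent hij)

end IsPlaneArrangement

/-- Two plane arrangements such that no plane of either contains a line in which two planes of the
other meet, phrased as in the proposition: the equation of one arrangement does not vanish on any
component of the singular locus of the other. -/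
structure IsTransverse [Fintype ι] [Fintype κ] (L : ι → Coord k) (M : κ → Coord k) : Prop where
  left : IsPlaneArrangement L
  right : IsPlaneArrangement M
  prod_right_notMem : ∀ P ∈ (jacobianIdeal (∏ i, L i)).minimalPrimes, ∏ j, M j ∉ P
  prod_left_notMem : ∀ P ∈ (jacobianIdeal (∏ j, M j)).minimalPrimes, ∏ i, L i ∉ P

namespace IsTransverse

variable [Fintype ι] [Fintype κ] {L : ι → Coord k} {M : κ → Coord k}

theorem symm (h : IsTransverse L M) : IsTransverse M L :=
  ⟨h.right, h.left, h.prod_left_notMem, h.prod_right_notMem⟩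

theorem isPrime_span_pair (h : IsTransverse L M) (i : ι) (j : κ) :
    (Ideal.span {L i, M j}).IsPrime :=
  ProductArrangement.isPrime_span_pair (h.left.isHomogeneous i) (h.right.isHomogeneous j)

variable [CharZero k] [Nontrivial ι]

theorem right_notMem_span_pair (h : IsTransverse L M) {i l : ι} (hil : i ≠ l) (j : κ) :
    M j ∉ Ideal.span {L i, L l} := fun hj =>
  h.prod_right_notMem _ (by rw [h.left.minimalPrimes_jacobianIdeal]; exact ⟨i, l, hil, rfl⟩)
    (Ideal.mem_of_dvd _ (Finset.dvd_prod_of_mem M (Finset.mem_univ j)) hj)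

theorem linearIndependent (h : IsTransverse L M) (i : ι) (j : κ) :
    LinearIndependent k ![L i, M j] := by
  rw [LinearIndependent.pair_iff' (h.left.ne_zero i)]
  intro a ha
  obtain ⟨l, hl⟩ := exists_ne i
  apply h.right_notMem_span_pair hl.symm j
  rw [← ha]
  exact ((Ideal.span {L i, L l}).restrictScalars k).smul_mem a (Ideal.subset_span (by simp))

theorem left_notMem_span_pair (h : IsTransverse L M) {i l : ι} (hil : i ≠ l) (j : κ) :
    L l ∉ Ideal.span {L i, M j} := fun hl => by
  have hle : Ideal.span {L i, L l} ≤ Ideal.span {L i, M j} :=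
    Ideal.span_le.mpr (Set.pair_subset (Ideal.subset_span (by simp)) hl)
  have heq := span_pair_eq_of_le (h.left.isHomogeneous i) (h.left.isHomogeneous l)
    (h.left.isHomogeneous i) (h.right.isHomogeneous j) (h.left.linearIndependent hil)
    (h.linearIndependent i j) hle
  exact h.right_notMem_span_pair hil j (heq ▸ Ideal.subset_span (by simp))

theorem isPlaneArrangement_sumElim (h : IsTransverse L M) :
    IsPlaneArrangement (Sum.elim L M) where
  isHomogeneous := Sum.forall.mpr ⟨h.left.isHomogeneous, h.right.isHomogeneous⟩
  linearIndependent := by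
    rintro (i | j) (i' | j') hne
    · exact h.left.linearIndependent fun e => hne (by rw [e])
    · exact h.linearIndependent i j'
    · exact LinearIndependent.pair_symm_iff.mp (h.linearIndependent i' j)
    · exact h.right.linearIndependent fun e => hne (by rw [e])

theorem prod_mul_prod_mem_jacobianIdeal (h : IsTransverse L M) :
    (∏ i, L i) * ∏ j, M j ∈ jacobianIdeal ((∏ i, L i) * ∏ j, M j) := by
  simpa using h.isPlaneArrangement_sumElim.prod_mem_jacobianIdeal

theorem isRelPrime_prod (h : IsTransverse L M) : IsRelPrime (∏ i, L i) (∏ j, M j) := by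
  refine IsRelPrime.prod_left fun i _ => IsRelPrime.prod_right fun j _ => ?_
  have hLi : Prime (L i) := (Ideal.span_singleton_prime (h.left.ne_zero i)).mp
    (isPrime_span_linearForms (by simp [h.left.isHomogeneous i]))
  rw [hLi.irreducible.isRelPrime_iff_not_dvd]
  obtain ⟨l, hl⟩ := exists_ne i
  exact fun hdvd => h.right_notMem_span_pair hl.symm j
    (Ideal.mem_of_dvd _ hdvd (Ideal.subset_span (by simp)))

variable [Nontrivial κ]

theorem minimalPrimes_jacobianIdeal_mul (h : IsTransverse L M) :
    (jacobianIdeal ((∏ i, L i) * ∏ j, M j)).minimalPrimes =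
      (jacobianIdeal (∏ i, L i)).minimalPrimes ∪ (jacobianIdeal (∏ j, M j)).minimalPrimes ∪
        {P | ∃ i j, P = Ideal.span {L i, M j}} := by
  have : Nontrivial (ι ⊕ κ) := Sum.inl_injective.nontrivial
  have hsum := h.isPlaneArrangement_sumElim.minimalPrimes_jacobianIdeal
  simp only [Fintype.prod_sum_type, Sum.elim_inl, Sum.elim_inr] at hsum
  rw [hsum, h.left.minimalPrimes_jacobianIdeal, h.right.minimalPrimes_jacobianIdeal]
  ext P
  constructor
  · rintro ⟨i | j, i' | j', hne, rfl⟩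
    · exact .inl (.inl ⟨i, i', fun e => hne (by rw [e]), rfl⟩)
    · exact .inr ⟨i, j', rfl⟩
    · exact .inr ⟨i', j, Set.pair_comm _ _ ▸ rfl⟩
    · exact .inl (.inr ⟨j, j', fun e => hne (by rw [e]), rfl⟩)
  · rintro ((⟨i, i', hne, rfl⟩ | ⟨j, j', hne, rfl⟩) | ⟨i, j, rfl⟩)
    · exact ⟨.inl i, .inl i', Sum.inl_injective.ne hne, rfl⟩
    · exact ⟨.inr j, .inr j', Sum.inr_injective.ne hne, rfl⟩
    · exact ⟨.inl i, .inr j, Sum.inl_ne_inr, rfl⟩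

theorem mem_span_prod_iff (h : IsTransverse L M) (f : Coord k) :
    f ∈ Ideal.span {∏ i, L i, ∏ j, M j} ↔ ∀ i j, f ∈ Ideal.span {L i, M j} := by
  have hrow (j : κ) (f : Coord k) :
      f ∈ Ideal.span {M j, ∏ i, L i} ↔ ∀ i, f ∈ Ideal.span {L i, M j} := by
    rw [Set.pair_comm, mem_span_prod_pair_iff]
    · simp only [Finset.mem_univ, true_imp_iff]
    · intro i l hil u hu
      exact ((h.isPrime_span_pair l j).mem_or_mem hu).resolve_left
        (h.left_notMem_span_pair hil.symm j)
  rw [Set.pair_comm, mem_span_prod_pair_iff]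
  · simp only [Finset.mem_univ, true_imp_iff, hrow]
    exact forall_comm
  · intro j l hjl u hu
    rw [hrow] at hu ⊢
    refine fun i => ((h.isPrime_span_pair i l).mem_or_mem (hu i)).resolve_left ?_
    rw [Set.pair_comm]
    exact h.symm.left_notMem_span_pair hjl.symm i

theorem locallyMem_jacobianIdeal_span_pair_iff (h : IsTransverse L M) (i : ι) (j : κ)
    {f : Coord k} :
    LocallyMem (jacobianIdeal ((∏ i, L i) * ∏ j, M j)) (Ideal.span {L i, M j}) f ↔
      f ∈ Ideal.span {L i, M j} := by
  classical
  have hP := h.isPrime_span_pair i j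
  have hind := h.linearIndependent i j
  set P := Ideal.span {L i, M j}
  have hJ : jacobianIdeal (L i * M j) = P := jacobianIdeal_mul_of_linearIndependent
    (h.left.isHomogeneous i) (h.right.isHomogeneous j) hind
  have hfactor : (∏ i, L i) * ∏ j, M j =
      L i * M j * ((∏ l ∈ Finset.univ.erase i, L l) * ∏ l ∈ Finset.univ.erase j, M l) := by
    rw [← Finset.mul_prod_erase _ L (Finset.mem_univ i),
      ← Finset.mul_prod_erase _ M (Finset.mem_univ j)]
    ring
  have hL : ∏ l ∈ Finset.univ.erase i, L l ∉ P := fun hm => by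
    obtain ⟨l, hl, hlP⟩ := hP.prod_mem_iff.mp hm
    exact h.left_notMem_span_pair (Finset.ne_of_mem_erase hl).symm j hlP
  have hM : ∏ l ∈ Finset.univ.erase j, M l ∉ P := fun hm => by
    obtain ⟨l, hl, hlP⟩ := hP.prod_mem_iff.mp hm
    exact h.symm.left_notMem_span_pair (Finset.ne_of_mem_erase hl).symm i
      (Set.pair_comm (L i) (M j) ▸ hlP)
  have hself := h.prod_mul_prod_mem_jacobianIdeal
  rw [hfactor] at hself ⊢
  have hab : L i * M j ∈ jacobianIdeal (L i * M j) := by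
    rw [hJ]
    exact P.mul_mem_right _ (Ideal.subset_span (by simp))
  rw [locallyMem_jacobianIdeal_mul_iff hab hself hP (hP.mul_notMem hL hM), hJ]
  exact ⟨fun ⟨s, hs, hsf⟩ => (hP.mem_or_mem hsf).resolve_left hs, locallyMem_of_mem hP.ne_top⟩

theorem radical_jacobianIdeal_mul (h : IsTransverse L M) :
    (jacobianIdeal ((∏ i, L i) * ∏ j, M j)).radical =
      liaisonSum (jacobianIdeal (∏ i, L i)).radical (jacobianIdeal (∏ j, M j)).radical
        (∏ i, L i) (∏ j, M j) := by
  rw [liaisonSum_eq_inf (Ideal.le_radical h.left.prod_mem_jacobianIdeal)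
    (Ideal.le_radical h.right.prod_mem_jacobianIdeal)
    (fun _ => mem_radical_of_mul_mem h.prod_right_notMem)
    (fun _ => mem_radical_of_mul_mem h.prod_left_notMem)]
  ext f
  simp only [Ideal.mem_inf, h.mem_span_prod_iff, ← Ideal.sInf_minimalPrimes,
    h.minimalPrimes_jacobianIdeal_mul, sInf_union, and_congr_right_iff, Ideal.mem_sInf]
  intro
  exact ⟨fun hf i j => hf ⟨i, j, rfl⟩, by rintro hf _ ⟨i, j, rfl⟩; exact hf i j⟩

theorem isolatedPart_jacobianIdeal_mul (h : IsTransverse L M) :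
    isolatedPart (jacobianIdeal ((∏ i, L i) * ∏ j, M j)) =
      liaisonSum (isolatedPart (jacobianIdeal (∏ i, L i)))
        (isolatedPart (jacobianIdeal (∏ j, M j))) (∏ i, L i) (∏ j, M j) := by
  have hself := h.prod_mul_prod_mem_jacobianIdeal
  have hL {P : Ideal (Coord k)} (hP : P ∈ (jacobianIdeal (∏ i, L i)).minimalPrimes) (f) :=
    locallyMem_jacobianIdeal_mul_iff (f := f) h.left.prod_mem_jacobianIdeal hself hP.1.1
      (h.prod_right_notMem P hP)
  have hM {P : Ideal (Coord k)} (hP : P ∈ (jacobianIdeal (∏ j, M j)).minimalPrimes) (f) :=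
    locallyMem_jacobianIdeal_mul_iff (f := f) h.right.prod_mem_jacobianIdeal
      (mul_comm (∏ i, L i) _ ▸ hself) hP.1.1 (h.prod_left_notMem P hP)
  rw [liaisonSum_eq_inf (le_isolatedPart h.left.prod_mem_jacobianIdeal)
    (le_isolatedPart h.right.prod_mem_jacobianIdeal)
    (fun _ => mem_isolatedPart_of_mul_mem h.prod_right_notMem)
    (fun _ => mem_isolatedPart_of_mul_mem h.prod_left_notMem)]
  ext f
  rw [Ideal.mem_inf, Ideal.mem_inf, h.mem_span_prod_iff]
  simp only [mem_isolatedPart, h.minimalPrimes_jacobianIdeal_mul]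
  constructor
  · intro hf
    refine ⟨⟨fun P hP => (hL hP f).mp (hf P (.inl (.inl hP))), fun P hP => (hM hP f).mp ?_⟩,
      fun i j => (h.locallyMem_jacobianIdeal_span_pair_iff i j).mp (hf _ (.inr ⟨i, j, rfl⟩))⟩
    rw [mul_comm]
    exact hf P (.inl (.inr hP))
  · rintro ⟨⟨hfL, hfM⟩, hfc⟩ P ((hP | hP) | ⟨i, j, rfl⟩)
    · exact (hL hP f).mpr (hfL P hP)
    · rw [mul_comm]
      exact (hM hP f).mpr (hfM P hP)
    · exact (h.locallyMem_jacobianIdeal_span_pair_iff i j).mpr (hfc i j)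

end IsTransverse

end Arrangement

section Fractions

variable {k : Type*} [Field k]

local notation "φ" => algebraMap (Coord k) (Frac k)

theorem algebraMap_ne_zero {h : Coord k} (h0 : h ≠ 0) : φ h ≠ 0 :=
  (map_ne_zero_iff _ (IsFractionRing.injective (Coord k) (Frac k))).mpr h0

theorem algebraMap_mem_fractionsOfDegree_iff {c : Coord k} {d : ℕ} :
    φ c ∈ fractionsOfDegree k d ↔ c.IsHomogeneous d := by
  constructor
  · rintro ⟨d', e, a, b, ha, hb, hb0, ht, h⟩
    obtain rfl : d' = e + d := by omega
    rw [← map_mul] at h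
    exact isHomogeneous_of_mul hb hb0 (IsFractionRing.injective (Coord k) (Frac k) h ▸ ha)
  · exact fun hc => ⟨d, 0, c, 1, hc, isHomogeneous_one _ _, one_ne_zero, by simp, by simp⟩

theorem eq_zero_of_algebraMap_mem_fractionsOfDegree {c : Coord k} {t : ℤ} (ht : t < 0)
    (hc : φ c ∈ fractionsOfDegree k t) : c = 0 := by
  obtain ⟨d, e, a, b, ha, hb, hb0, hde, h⟩ := hc
  rw [← map_mul] at h
  have hbc : b * c = a := IsFractionRing.injective (Coord k) (Frac k) h
  have hbc0 : b * c = 0 := by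
    rw [← homogeneousComponent_mul_of_lt hb c (d := d) (by omega), hbc,
      homogeneousComponent_eq_self ha]
  exact (mul_eq_zero.mp hbc0).resolve_left hb0

theorem smul_mem_fractionsOfDegree {b : Coord k} {e : ℕ} (hb : b.IsHomogeneous e)
    {g : Frac k} {t s : ℤ} (hs : t + e = s) (hg : g ∈ fractionsOfDegree k t) :
    b • g ∈ fractionsOfDegree k s := by
  obtain ⟨d, e', a, b', ha, hb', hb0, ht, h⟩ := hg
  refine ⟨e + d, e', b * a, b', hb.mul ha, hb', hb0, by push_cast; omega, ?_⟩
  rw [map_mul, ← h, mul_smul_comm, Algebra.smul_def]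

theorem mem_fractionsOfDegree_of_smul_mem {b : Coord k} {e : ℕ} (hb : b.IsHomogeneous e)
    (hb0 : b ≠ 0) {g : Frac k} {t s : ℤ} (hs : t + e = s) (hg : b • g ∈ fractionsOfDegree k s) :
    g ∈ fractionsOfDegree k t := by
  obtain ⟨d, e', a, b', ha, hb', hb0', ht, h⟩ := hg
  refine ⟨d, e' + e, a, b' * b, ha, hb'.mul hb, mul_ne_zero hb0' hb0, by push_cast; omega, ?_⟩
  rw [map_mul, ← h, mul_assoc, ← Algebra.smul_def b]

end Fractions

section Sections

variable {k : Type*} [Field k] {I J : Ideal (Coord k)}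

theorem mem_sectionsOn {h : Coord k} {g : Frac k} :
    g ∈ sectionsOn I h ↔ ∃ n : ℕ, ∃ f ∈ I, h ^ n • g = algebraMap (Coord k) (Frac k) f := by
  simp only [Algebra.smul_def]
  rfl

theorem sectionsOn_le_top (h : Coord k) : sectionsOn I h ≤ sectionsOn ⊤ h := by
  rintro g ⟨n, f, -, hf⟩
  exact ⟨n, f, trivial, hf⟩

theorem sectionsOn_le_of_dvd {h h' : Coord k} (hh : h ∣ h') :
    sectionsOn I h ≤ sectionsOn I h' := by
  rintro g ⟨n, f, hfI, hf⟩
  obtain ⟨w, rfl⟩ := hh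
  refine ⟨n, w ^ n * f, I.mul_mem_left _ hfI, ?_⟩
  rw [mul_pow, map_mul, map_mul, ← hf]
  ring

theorem smul_mem_sectionsOn {c : Coord k} (hc : ∀ x ∈ I, c * x ∈ J) {h : Coord k} {g : Frac k}
    (hg : g ∈ sectionsOn I h) : c • g ∈ sectionsOn J h := by
  obtain ⟨n, f, hfI, hf⟩ := hg
  refine ⟨n, c * f, hc f hfI, ?_⟩
  rw [map_mul, ← hf, mul_smul_comm, Algebra.smul_def]

theorem smul_mem_sectionsOn_of_mem {c : Coord k} (hc : c ∈ J) {h : Coord k} {g : Frac k}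
    (hg : g ∈ sectionsOn ⊤ h) : c • g ∈ sectionsOn J h :=
  smul_mem_sectionsOn (fun _ _ => J.mul_mem_right _ hc) hg

theorem delta₀_mem_sectionsOn {b : Fin 4 → Frac k} (hb : ∀ i, b i ∈ sectionsOn I (X i))
    (i j : Fin 4) : b j - b i ∈ sectionsOn I (X i * X j) :=
  Submodule.sub_mem _ (sectionsOn_le_of_dvd (dvd_mul_left _ _) (hb j))
    (sectionsOn_le_of_dvd (dvd_mul_right _ _) (hb i))

theorem delta₁_mem_sectionsOn {c : Fin 4 → Fin 4 → Frac k}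
    (hc : ∀ i j, c i j ∈ sectionsOn I (X i * X j)) (i j l : Fin 4) :
    c j l - c i l + c i j ∈ sectionsOn I (X i * X j * X l) := by
  refine Submodule.add_mem _ (Submodule.sub_mem _ ?_ ?_) ?_
  · exact sectionsOn_le_of_dvd ⟨X i, by ring⟩ (hc j l)
  · exact sectionsOn_le_of_dvd ⟨X j, by ring⟩ (hc i l)
  · exact sectionsOn_le_of_dvd ⟨X l, by ring⟩ (hc i j)

theorem mem_cocycle₁_iff {c : Fin 4 → Fin 4 → Frac k} :
    c ∈ cocycle₁ I ↔
      (∀ i j, c i j ∈ sectionsOn I (X i * X j)) ∧ ∀ i j l, c j l - c i l + c i j = 0 := by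
  refine and_congr Iff.rfl ?_
  rw [SetLike.mem_coe, LinearMap.mem_ker]
  simp only [funext_iff]
  rfl

theorem mem_coboundary₁_iff {c : Fin 4 → Fin 4 → Frac k} :
    c ∈ coboundary₁ I ↔
      ∃ b : Fin 4 → Frac k, (∀ i, b i ∈ sectionsOn I (X i)) ∧ ∀ i j, b j - b i = c i j := by
  refine exists_congr fun b => and_congr Iff.rfl ?_
  simp only [funext_iff]
  rfl

end Sections

section Contraction

variable {σ R : Type*} [CommSemiring R]

theorem X_pow_dvd_iff {p : MvPolynomial σ R} {q : σ} {n : ℕ} :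
    X q ^ n ∣ p ↔ ∀ e, coeff e p ≠ 0 → n ≤ e q := by
  rw [X_pow_eq_monomial, monomial_one_dvd_iff_modMonomial_eq_zero]
  simp only [← Finsupp.single_le_iff]
  constructor
  · intro h e he
    by_contra hn
    exact he (by rw [← coeff_modMonomial_of_not_le p hn, h, coeff_zero])
  · intro h
    ext e
    by_cases hle : Finsupp.single q n ≤ e
    · exact coeff_modMonomial_of_le p hle
    · rw [coeff_modMonomial_of_not_le p hle]
      exact not_not.mp (mt (h e) hle)

variable [Nonempty σ]

/-- A variable whose exponent in `e` is at least `n`, provided that there is one. -/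
def apex (n : ℕ) (e : σ →₀ ℕ) : σ :=
  Classical.epsilon fun q => n ≤ e q

theorem le_apply_apex {n : ℕ} {e : σ →₀ ℕ} {q : σ} (h : n ≤ e q) : n ≤ e (apex n e) :=
  Classical.epsilon_spec (p := fun q => n ≤ e q) ⟨q, h⟩

variable [Fintype σ]

/-- The contracting homotopy of the Čech complex of the polynomial ring. After multiplication by
the `n`-th power of the product of all variables, the part of the complex spanned by the monomial
with exponent `e` is the cochain complex of a simplex, and `apex n e` is the vertex towards which
it is contracted: `contract n f` takes its coefficient at `e` from `f (apex n e)`. -/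
def contract (n : ℕ) (f : σ → MvPolynomial σ R) : MvPolynomial σ R :=
  open Classical in ∑ v, ∑ e ∈ (f v).support with apex n e = v, monomial e (coeff e (f v))

theorem coeff_contract (n : ℕ) (f : σ → MvPolynomial σ R) (e : σ →₀ ℕ) :
    coeff e (contract n f) = coeff e (f (apex n e)) := by
  classical
  simp only [contract, coeff_sum, coeff_monomial, Finset.sum_ite_eq', Finset.mem_filter]
  rw [Finset.sum_eq_single (apex n e) (fun v _ hv => if_neg fun h => hv h.2.symm) (by simp)]
  simp [eq_comm]

theorem isHomogeneous_contract {n : ℕ} {f : σ → MvPolynomial σ R} {d : ℕ}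
    (hf : ∀ v, (f v).IsHomogeneous d) : (contract n f).IsHomogeneous d := by
  intro e he
  rw [coeff_contract] at he
  exact hf _ he

theorem X_pow_dvd_contract {n : ℕ} {f : σ → MvPolynomial σ R} {T : Finset σ}
    (hT : T.card + 1 < Fintype.card σ) (hf : ∀ v, ∀ q ∉ T, q ≠ v → X q ^ n ∣ f v) {q : σ}
    (hq : q ∉ T) : X q ^ n ∣ contract n f := by
  classical
  simp only [X_pow_dvd_iff, coeff_contract] at hf ⊢
  intro e he
  obtain rfl | hqv := eq_or_ne q (apex n e)
  · obtain ⟨r, hr⟩ : ∃ r, r ∉ insert (apex n e) T := by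
      by_contra! hall
      have hcard := Finset.card_insert_le (apex n e) T
      rw [Finset.eq_univ_iff_forall.mpr hall, Finset.card_univ] at hcard
      omega
    rw [Finset.mem_insert, not_or] at hr
    exact le_apply_apex (hf _ r hr.2 hr.1 e he)
  · exact hf _ q hq hqv e he

end Contraction

section Cech

variable {k : Type*} [Field k]

theorem exists_polynomial_cochain₀ {n : ℕ} {p : Fin 4 → Fin 4 → Coord k}
    (hp : ∀ i j r, ¬ X r ∣ (X i * X j : Coord k) → X r ^ n ∣ p i j)
    (hδ : ∀ i j l, p j l - p i l + p i j = 0) :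
    ∃ q : Fin 4 → Coord k, (∀ i r, ¬ X r ∣ (X i : Coord k) → X r ^ n ∣ q i) ∧
      ∀ i j, q j - q i = p i j := by
  refine ⟨fun i => contract n fun v => p v i, fun i r hr => ?_, fun i j => ?_⟩
  · refine X_pow_dvd_contract (T := {i}) (by simp) (fun v s hs hsv => hp v i s ?_) ?_
    · simpa [X_prime.dvd_mul, hsv] using hs
    · simpa using hr
  · ext e
    have h := congrArg (coeff e) (hδ (apex n e) i j)
    simp only [coeff_add, coeff_sub, coeff_zero, coeff_contract] at h ⊢
    linear_combination -h

theorem exists_polynomial_cochain₁ {n : ℕ} {p : Fin 4 → Fin 4 → Fin 4 → Coord k}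
    (hp : ∀ i j l r, ¬ X r ∣ (X i * X j * X l : Coord k) → X r ^ n ∣ p i j l)
    (hδ : ∀ i j l r, p j l r - p i l r + p i j r - p i j l = 0) :
    ∃ q : Fin 4 → Fin 4 → Coord k, (∀ i j r, ¬ X r ∣ (X i * X j : Coord k) → X r ^ n ∣ q i j) ∧
      (∀ i j l, q j l - q i l + q i j = p i j l) ∧
      ∀ d, (∀ i j l, (p i j l).IsHomogeneous d) → ∀ i j, (q i j).IsHomogeneous d := by
  refine ⟨fun i j => contract n fun v => p v i j, fun i j r hr => ?_, fun i j l => ?_,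
    fun d hd i j => isHomogeneous_contract fun v => hd v i j⟩
  · refine X_pow_dvd_contract (T := {i, j}) ?_ (fun v s hs hsv => hp v i j s ?_) ?_
    · have := Finset.card_le_two (a := i) (b := j)
      simp only [Fintype.card_fin]
      omega
    · simpa [X_prime.dvd_mul, hsv] using hs
    · simpa [X_prime.dvd_mul] using hr
  · ext e
    have h := congrArg (coeff e) (hδ (apex n e) i j l)
    simp only [coeff_add, coeff_sub, coeff_zero, coeff_contract] at h ⊢
    linear_combination -h

/-- The product of the four variables, whose powers serve as common denominators of all sections
in the Čech complex. -/
def allX (k : Type*) [Field k] : Coord k :=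
  ∏ i : Fin 4, X i

theorem allX_ne_zero : allX k ≠ 0 :=
  Finset.prod_ne_zero_iff.mpr fun i _ => X_ne_zero i

theorem isHomogeneous_allX : (allX k).IsHomogeneous 4 := by
  simpa [allX] using IsHomogeneous.prod Finset.univ (fun i : Fin 4 => (X i : Coord k))
    (fun _ => 1) fun i _ => isHomogeneous_X k i

theorem X_dvd_allX (i : Fin 4) : X i ∣ allX k :=
  Finset.dvd_prod_of_mem _ (Finset.mem_univ i)

theorem prod_X_pow_dvd {s : Finset (Fin 4)} {n : ℕ} {p : Coord k}
    (h : ∀ q ∈ s, X q ^ n ∣ p) : ∏ q ∈ s, X q ^ n ∣ p := by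
  refine Finset.prod_dvd_of_isRelPrime (fun i _ j _ hij => IsRelPrime.pow ?_) h
  exact X_prime.irreducible.isRelPrime_iff_not_dvd.mpr fun hd => hij (X_dvd_X.mp hd)

theorem eventually_exists_numerator {h : Coord k} {g : Frac k} {m : ℕ}
    (hg : g ∈ sectionsOn ⊤ h) (hdvd : h ∣ allX k ^ m) :
    ∀ᶠ n : ℕ in Filter.atTop, ∃ p : Coord k,
      allX k ^ n • g = algebraMap (Coord k) (Frac k) p ∧ ∀ q, ¬ X q ∣ h → X q ^ n ∣ p := by
  obtain ⟨r, f, -, hf⟩ := mem_sectionsOn.mp hg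
  obtain ⟨w, hw⟩ := hdvd
  filter_upwards [Filter.eventually_ge_atTop (m * r)] with n hn
  obtain ⟨s, rfl⟩ := Nat.exists_eq_add_of_le hn
  have hX : allX k ^ (m * r + s) = allX k ^ s * w ^ r * h ^ r := by
    rw [pow_add, pow_mul, hw]
    ring
  refine ⟨allX k ^ s * w ^ r * f, ?_, fun q hq => ?_⟩
  · rw [hX, mul_smul, hf, Algebra.smul_def, ← map_mul]
  · refine X_prime.pow_dvd_of_dvd_mul_left _ (fun hd => hq (X_prime.dvd_of_dvd_pow hd))
      (Dvd.dvd.trans ?_ (?_ : allX k ^ (m * r + s) ∣ h ^ r * (allX k ^ s * w ^ r * f)))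
    · exact pow_dvd_pow_of_dvd (X_dvd_allX q) _
    · exact ⟨f, by rw [hX]; ring⟩

theorem mem_sectionsOn_top_of_dvd {h p : Coord k} {n : ℕ} {g : Frac k}
    (hp : ∀ q, ¬ X q ∣ h → X q ^ n ∣ p)
    (hg : allX k ^ n • g = algebraMap (Coord k) (Frac k) p) : g ∈ sectionsOn ⊤ h := by
  classical
  obtain ⟨T, hT⟩ : ∃ T : Finset (Fin 4), ∀ q, q ∈ T ↔ X q ∣ h :=
    ⟨Finset.univ.filter fun q => X q ∣ h, by simp⟩
  obtain ⟨w, hw⟩ : ∏ q ∈ T, X q ^ n ∣ h ^ n :=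
    prod_X_pow_dvd fun q hq => pow_dvd_pow_of_dvd ((hT q).mp hq) n
  obtain ⟨c, hc⟩ : ∏ q ∈ Tᶜ, X q ^ n ∣ p :=
    prod_X_pow_dvd fun q hq => hp q fun hqh => Finset.mem_compl.mp hq ((hT q).mpr hqh)
  refine mem_sectionsOn.mpr ⟨n, w * c, Submodule.mem_top, ?_⟩
  have h0 := algebraMap_ne_zero (pow_ne_zero n (allX_ne_zero (k := k)))
  rw [Algebra.smul_def] at hg ⊢
  refine mul_left_cancel₀ h0 ?_
  rw [mul_left_comm, hg, ← map_mul, ← map_mul, hw, hc, allX, ← Finset.prod_pow,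
    ← Finset.prod_mul_prod_compl T]
  congr 1
  ring

/-- `H¹(ℙ³, 𝓞(t)) = 0` for all `t`. -/
theorem exists_cochain₀_of_cocycle {c : Fin 4 → Fin 4 → Frac k}
    (hc : ∀ i j, c i j ∈ sectionsOn ⊤ (X i * X j)) (hδ : ∀ i j l, c j l - c i l + c i j = 0) :
    ∃ d : Fin 4 → Frac k, (∀ i, d i ∈ sectionsOn ⊤ (X i)) ∧ ∀ i j, d j - d i = c i j := by
  have hnum := Filter.eventually_all.mpr fun i => Filter.eventually_all.mpr fun j =>
    eventually_exists_numerator (m := 2) (hc i j)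
      (by simpa only [pow_two] using mul_dvd_mul (X_dvd_allX i) (X_dvd_allX j))
  obtain ⟨n, hn⟩ := hnum.exists
  choose p hp hpX using hn
  have h0 := algebraMap_ne_zero (pow_ne_zero n (allX_ne_zero (k := k)))
  obtain ⟨q, hqX, hqδ⟩ := exists_polynomial_cochain₀ hpX fun i j l => by
    apply IsFractionRing.injective (Coord k) (Frac k)
    simp only [map_add, map_sub, ← hp, ← smul_sub, ← smul_add, hδ, smul_zero, map_zero]
  refine ⟨fun i => algebraMap _ _ (q i) / algebraMap _ _ (allX k ^ n), fun i => ?_, fun i j => ?_⟩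
  · exact mem_sectionsOn_top_of_dvd (hqX i) (by rw [Algebra.smul_def, mul_div_cancel₀ _ h0])
  · rw [← sub_div, ← map_sub, hqδ, ← hp, Algebra.smul_def, mul_div_cancel_left₀ _ h0]

/-- `H²(ℙ³, 𝓞(t)) = 0` for all `t`. -/
theorem exists_cochain₁_of_cocycle (t : ℤ) {c : Fin 4 → Fin 4 → Fin 4 → Frac k}
    (hc : ∀ i j l, c i j l ∈ sectionsOn ⊤ (X i * X j * X l))
    (hδ : ∀ i j l r, c j l r - c i l r + c i j r - c i j l = 0) :
    ∃ d : Fin 4 → Fin 4 → Frac k, (∀ i j, d i j ∈ sectionsOn ⊤ (X i * X j)) ∧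
      (∀ i j l, d j l - d i l + d i j = c i j l) ∧
      ((∀ i j l, c i j l ∈ fractionsOfDegree k t) → ∀ i j, d i j ∈ fractionsOfDegree k t) := by
  have hnum := Filter.eventually_all.mpr fun i => Filter.eventually_all.mpr fun j =>
    Filter.eventually_all.mpr fun l => eventually_exists_numerator (m := 3) (hc i j l)
      (by simpa only [pow_succ, pow_zero, one_mul] using
        mul_dvd_mul (mul_dvd_mul (X_dvd_allX i) (X_dvd_allX j)) (X_dvd_allX l))
  obtain ⟨n, hn, hnt⟩ := (hnum.and (Filter.eventually_ge_atTop t.natAbs)).exists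
  choose p hp hpX using hn
  have h0 := algebraMap_ne_zero (pow_ne_zero n (allX_ne_zero (k := k)))
  obtain ⟨q, hqX, hqδ, hqdeg⟩ := exists_polynomial_cochain₁ hpX fun i j l r => by
    apply IsFractionRing.injective (Coord k) (Frac k)
    simp only [map_add, map_sub, ← hp, ← smul_sub, ← smul_add, hδ, smul_zero, map_zero]
  have hq : ∀ i j, allX k ^ n • (algebraMap (Coord k) (Frac k) (q i j) /
      algebraMap (Coord k) (Frac k) (allX k ^ n)) = algebraMap (Coord k) (Frac k) (q i j) :=
    fun i j => by rw [Algebra.smul_def, mul_div_cancel₀ _ h0]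
  refine ⟨fun i j => algebraMap _ _ (q i j) / algebraMap _ _ (allX k ^ n),
    fun i j => mem_sectionsOn_top_of_dvd (hqX i j) (hq i j), fun i j l => ?_, fun ht i j => ?_⟩
  · rw [← sub_div, ← add_div, ← map_sub, ← map_add, hqδ, ← hp, Algebra.smul_def,
      mul_div_cancel_left₀ _ h0]
  · have hX : (allX k ^ n).IsHomogeneous (4 * n) := isHomogeneous_allX.pow n
    obtain ⟨d, hd⟩ : ∃ d : ℕ, t + (4 * n : ℕ) = d := ⟨(t + (4 * n : ℕ)).toNat, by omega⟩
    refine mem_fractionsOfDegree_of_smul_mem hX (pow_ne_zero _ allX_ne_zero) hd ?_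
    rw [hq, algebraMap_mem_fractionsOfDegree_iff]
    refine hqdeg d (fun i j l => ?_) i j
    rw [← algebraMap_mem_fractionsOfDegree_iff, ← hp]
    exact smul_mem_fractionsOfDegree hX hd (ht i j l)

end Cech

section LiaisonAddition

attribute [local instance] MvPolynomial.gradedAlgebra

variable {k : Type*} [Field k] {A B : Ideal (Coord k)} {F G : Coord k} {m p : ℕ}

/-- The data of a liaison addition: homogeneous ideals `A` and `B` with forms `F ∈ A` and `G ∈ B`
of degrees `m` and `p` without common factor. The resulting ideal is `liaisonSum A B F G`. -/
structure IsLiaisonData (A B : Ideal (Coord k)) (F G : Coord k) (m p : ℕ) : Prop where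
  isHomogeneous_fst : A.IsHomogeneous (homogeneousSubmodule (Fin 4) k)
  isHomogeneous_snd : B.IsHomogeneous (homogeneousSubmodule (Fin 4) k)
  isHomogeneous_left : F.IsHomogeneous m
  isHomogeneous_right : G.IsHomogeneous p
  left_mem : F ∈ A
  right_mem : G ∈ B
  left_ne_zero : F ≠ 0
  isRelPrime : IsRelPrime F G

local notation "φ" => algebraMap (Coord k) (Frac k)

theorem exists_mul_eq_homogeneousComponent_mul
    (hA : A.IsHomogeneous (homogeneousSubmodule (Fin 4) k)) (hG : G.IsHomogeneous p)
    {a : Coord k} (ha : a ∈ A) (d : ℕ) :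
    ∃ a' ∈ A, G * a' = homogeneousComponent d (G * a) ∧
      φ a' ∈ fractionsOfDegree k ((d : ℤ) - p) := by
  obtain hdp | hpd := lt_or_ge d p
  · refine ⟨0, A.zero_mem, ?_, ?_⟩
    · rw [homogeneousComponent_mul_of_lt hG a hdp, mul_zero]
    · rw [map_zero]
      exact Submodule.zero_mem _
  · obtain ⟨r, rfl⟩ := Nat.exists_eq_add_of_le hpd
    refine ⟨homogeneousComponent r a, homogeneousComponent_mem_of_mem hA ha r,
      (homogeneousComponent_add_mul hG a r).symm, ?_⟩
    rw [Nat.cast_add, add_sub_cancel_left, algebraMap_mem_fractionsOfDegree_iff]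
    exact homogeneousComponent_isHomogeneous r a

namespace IsLiaisonData

theorem exists_add_eq_of_algebraMap_mem (H : IsLiaisonData A B F G m p) {f : Coord k}
    (hf : f ∈ liaisonSum A B F G) {s : ℤ} (hs : φ f ∈ fractionsOfDegree k s) :
    ∃ a ∈ A, ∃ b ∈ B, G * a + F * b = f ∧
      φ a ∈ fractionsOfDegree k (s - p) ∧ φ b ∈ fractionsOfDegree k (s - m) := by
  obtain hneg | hnonneg := lt_or_ge s 0
  · refine ⟨0, A.zero_mem, 0, B.zero_mem, ?_, ?_⟩
    · rw [eq_zero_of_algebraMap_mem_fractionsOfDegree hneg hs, mul_zero, mul_zero, add_zero]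
    · rw [map_zero]
      exact ⟨Submodule.zero_mem _, Submodule.zero_mem _⟩
  · lift s to ℕ using hnonneg
    obtain ⟨a, ha, b, hb, rfl⟩ := mem_liaisonSum.mp hf
    obtain ⟨a', ha', hGa, hda⟩ :=
      exists_mul_eq_homogeneousComponent_mul H.isHomogeneous_fst H.isHomogeneous_right ha s
    obtain ⟨b', hb', hFb, hdb⟩ :=
      exists_mul_eq_homogeneousComponent_mul H.isHomogeneous_snd H.isHomogeneous_left hb s
    refine ⟨a', ha', b', hb', ?_, hda, hdb⟩
    rw [hGa, hFb, ← map_add,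
      homogeneousComponent_eq_self (algebraMap_mem_fractionsOfDegree_iff.mp hs)]

theorem exists_add_eq (H : IsLiaisonData A B F G m p) {f : Coord k}
    (hf : f ∈ liaisonSum A B F G) (s : ℤ) :
    ∃ a ∈ A, ∃ b ∈ B, G * a + F * b = f ∧ (φ f ∈ fractionsOfDegree k s →
      φ a ∈ fractionsOfDegree k (s - p) ∧ φ b ∈ fractionsOfDegree k (s - m)) := by
  by_cases hs : φ f ∈ fractionsOfDegree k s
  · obtain ⟨a, ha, b, hb, hab, hdeg⟩ := H.exists_add_eq_of_algebraMap_mem hf hs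
    exact ⟨a, ha, b, hb, hab, fun _ => hdeg⟩
  · obtain ⟨a, ha, b, hb, hab⟩ := mem_liaisonSum.mp hf
    exact ⟨a, ha, b, hb, hab, fun h => absurd h hs⟩

theorem exists_smul_add_smul_eq (H : IsLiaisonData A B F G m p) {h : Coord k} (h0 : h ≠ 0) {e : ℕ}
    (he : h.IsHomogeneous e) (t : ℤ) {g : Frac k} (hg : g ∈ sectionsOn (liaisonSum A B F G) h) :
    ∃ a ∈ sectionsOn A h, ∃ b ∈ sectionsOn B h, G • a + F • b = g ∧
      (g ∈ fractionsOfDegree k t →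
        a ∈ fractionsOfDegree k (t - p) ∧ b ∈ fractionsOfDegree k (t - m)) := by
  obtain ⟨n, f, hfI, hf⟩ := mem_sectionsOn.mp hg
  obtain ⟨a, ha, b, hb, hab, hdeg⟩ := H.exists_add_eq hfI (t + (e * n : ℕ))
  have hn0 : h ^ n ≠ 0 := pow_ne_zero _ h0
  have hen : (h ^ n).IsHomogeneous (e * n) := he.pow n
  have hdiv : ∀ c, h ^ n • (φ c / φ (h ^ n)) = φ c := fun c => by
    rw [Algebra.smul_def, mul_div_cancel₀ _ (algebraMap_ne_zero hn0)]
  refine ⟨φ a / φ (h ^ n), mem_sectionsOn.mpr ⟨n, a, ha, hdiv a⟩, φ b / φ (h ^ n),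
    mem_sectionsOn.mpr ⟨n, b, hb, hdiv b⟩, ?_, fun ht => ?_⟩
  · refine smul_right_injective (Frac k) hn0 ?_
    change h ^ n • (G • (φ a / φ (h ^ n)) + F • (φ b / φ (h ^ n))) = h ^ n • g
    rw [hf, ← hab, smul_add, smul_comm, hdiv, smul_comm, hdiv, map_add, map_mul, map_mul,
      Algebra.smul_def, Algebra.smul_def]
  · obtain ⟨hda, hdb⟩ := hdeg (hf ▸ smul_mem_fractionsOfDegree hen rfl ht)
    exact ⟨mem_fractionsOfDegree_of_smul_mem hen hn0 (by ring) ((hdiv a).symm ▸ hda),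
      mem_fractionsOfDegree_of_smul_mem hen hn0 (by ring) ((hdiv b).symm ▸ hdb)⟩

theorem smul_left_injective (H : IsLiaisonData A B F G m p) :
    Function.Injective fun g : Frac k => F • g :=
  smul_right_injective (Frac k) H.left_ne_zero

theorem exists_syzygy (H : IsLiaisonData A B F G m p) {h : Coord k} (h0 : h ≠ 0)
    {a b : Frac k} (ha : a ∈ sectionsOn ⊤ h) (hb : b ∈ sectionsOn ⊤ h) (hab : G • a + F • b = 0) :
    ∃ c ∈ sectionsOn ⊤ h, F • c = a ∧ G • c = -b := by
  obtain ⟨n, f, -, hf⟩ := mem_sectionsOn.mp ha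
  obtain ⟨r, f', -, hf'⟩ := mem_sectionsOn.mp hb
  have hGf : G * (h ^ r * f) = F * -(h ^ n * f') := by
    apply IsFractionRing.injective (Coord k) (Frac k)
    rw [map_mul, map_mul, map_mul, map_neg, map_mul, ← hf, ← hf']
    simp only [← Algebra.smul_def]
    linear_combination (norm := module) (h ^ n * h ^ r) • hab
  obtain ⟨c, hc⟩ : F ∣ h ^ r * f := H.isRelPrime.dvd_of_dvd_mul_left ⟨_, hGf⟩
  have hι := pow_ne_zero (n + r) h0
  have hdiv : h ^ (n + r) • (φ c / φ (h ^ (n + r))) = φ c := by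
    rw [Algebra.smul_def, mul_div_cancel₀ _ (algebraMap_ne_zero hι)]
  have hFc : F • (φ c / φ (h ^ (n + r))) = a := by
    refine smul_right_injective (Frac k) hι ?_
    change h ^ (n + r) • F • (φ c / φ (h ^ (n + r))) = h ^ (n + r) • a
    rw [smul_comm, hdiv, Algebra.smul_def, ← map_mul, ← hc, map_mul, ← hf, pow_add,
      ← Algebra.smul_def, ← mul_smul, mul_comm]
  refine ⟨φ c / φ (h ^ (n + r)), mem_sectionsOn.mpr ⟨n + r, c, Submodule.mem_top, hdiv⟩, hFc,
    H.smul_left_injective ?_⟩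
  change F • G • (φ c / φ (h ^ (n + r))) = F • -b
  rw [smul_comm, hFc]
  linear_combination (norm := module) hab

theorem exists_cochain₁_add_eq (H : IsLiaisonData A B F G m p) (t : ℤ)
    {z : Fin 4 → Fin 4 → Frac k} (hz : ∀ i j, z i j ∈ sectionsOn (liaisonSum A B F G) (X i * X j)) :
    ∃ a b : Fin 4 → Fin 4 → Frac k, (∀ i j, a i j ∈ sectionsOn A (X i * X j)) ∧
      (∀ i j, b i j ∈ sectionsOn B (X i * X j)) ∧ (∀ i j, G • a i j + F • b i j = z i j) ∧
      ((∀ i j, z i j ∈ fractionsOfDegree k t) →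
        (∀ i j, a i j ∈ fractionsOfDegree k (t - p)) ∧
        ∀ i j, b i j ∈ fractionsOfDegree k (t - m)) := by
  choose a ha b hb hab hdeg using fun i j =>
    H.exists_smul_add_smul_eq (mul_ne_zero (X_ne_zero i) (X_ne_zero j))
      ((isHomogeneous_X k i).mul (isHomogeneous_X k j)) t (hz i j)
  exact ⟨a, b, ha, hb, hab, fun ht =>
    ⟨fun i j => (hdeg i j (ht i j)).1, fun i j => (hdeg i j (ht i j)).2⟩⟩

/-- The obstruction to correcting `(a, b)` to a pair of cocycles is a `2`-cocycle `c` of the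
structure sheaf, and that is a coboundary. -/
theorem exists_correction (H : IsLiaisonData A B F G m p) (t : ℤ)
    {a b : Fin 4 → Fin 4 → Frac k} (ha : ∀ i j, a i j ∈ sectionsOn A (X i * X j))
    (hb : ∀ i j, b i j ∈ sectionsOn B (X i * X j))
    (hδ : ∀ i j l, G • (a j l - a i l + a i j) + F • (b j l - b i l + b i j) = 0) :
    ∃ d : Fin 4 → Fin 4 → Frac k, (∀ i j, d i j ∈ sectionsOn ⊤ (X i * X j)) ∧
      (∀ i j l, F • (d j l - d i l + d i j) = a j l - a i l + a i j) ∧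
      (∀ i j l, G • (d j l - d i l + d i j) = -(b j l - b i l + b i j)) ∧
      ((∀ i j, a i j ∈ fractionsOfDegree k t) → ∀ i j, d i j ∈ fractionsOfDegree k (t - m)) := by
  choose c hc hca hcb using fun i j l =>
    H.exists_syzygy (mul_ne_zero (mul_ne_zero (X_ne_zero i) (X_ne_zero j)) (X_ne_zero l))
      (sectionsOn_le_top _ (delta₁_mem_sectionsOn ha i j l))
      (sectionsOn_le_top _ (delta₁_mem_sectionsOn hb i j l)) (hδ i j l)
  have hcδ : ∀ i j l r, c j l r - c i l r + c i j r - c i j l = 0 := fun i j l r => by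
    refine H.smul_left_injective ?_
    simp only [smul_sub, smul_add, hca, smul_zero]
    ring
  obtain ⟨d, hd, hdc, hdeg⟩ := exists_cochain₁_of_cocycle (t - m) hc hcδ
  refine ⟨d, hd, fun i j l => by rw [hdc, hca], fun i j l => by rw [hdc, hcb],
    fun ht => hdeg fun i j l => ?_⟩
  refine mem_fractionsOfDegree_of_smul_mem H.isHomogeneous_left H.left_ne_zero
    (sub_add_cancel _ _) ?_
  rw [hca]
  exact Submodule.add_mem _ (Submodule.sub_mem _ (ht j l) (ht i l)) (ht i j)

theorem exists_cocycle₁_add_eq (H : IsLiaisonData A B F G m p) (t : ℤ)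
    {z : Fin 4 → Fin 4 → Frac k} (hz : z ∈ cocycle₁ (liaisonSum A B F G)) :
    ∃ a ∈ cocycle₁ A, ∃ b ∈ cocycle₁ B, G • a + F • b = z ∧
      ((∀ i j, z i j ∈ fractionsOfDegree k t) →
        (∀ i j, a i j ∈ fractionsOfDegree k (t - p)) ∧
        ∀ i j, b i j ∈ fractionsOfDegree k (t - m)) := by
  simp only [mem_cocycle₁_iff] at hz ⊢
  obtain ⟨hzI, hzδ⟩ := hz
  obtain ⟨a, b, ha, hb, hab, hdeg⟩ := H.exists_cochain₁_add_eq t hzI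
  obtain ⟨d, hd, hda, hdb, hddeg⟩ := H.exists_correction (t - p) ha hb fun i j l => by
    rw [← hzδ i j l, ← hab, ← hab, ← hab]
    module
  refine ⟨fun i j => a i j - F • d i j, ⟨fun i j => ?_, fun i j l => ?_⟩,
    fun i j => b i j + G • d i j, ⟨fun i j => ?_, fun i j l => ?_⟩, ?_, fun ht => ?_⟩
  · exact Submodule.sub_mem _ (ha i j) (smul_mem_sectionsOn_of_mem H.left_mem (hd i j))
  · linear_combination (norm := module) -hda i j l
  · exact Submodule.add_mem _ (hb i j) (smul_mem_sectionsOn_of_mem H.right_mem (hd i j))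
  · linear_combination (norm := module) hdb i j l
  · funext i j
    rw [← hab]
    simp only [Pi.add_apply, Pi.smul_apply]
    module
  · obtain ⟨hta, htb⟩ := hdeg ht
    have htd := hddeg hta
    exact ⟨fun i j => Submodule.sub_mem _ (hta i j)
        (smul_mem_fractionsOfDegree H.isHomogeneous_left (by ring) (htd i j)),
      fun i j => Submodule.add_mem _ (htb i j)
        (smul_mem_fractionsOfDegree H.isHomogeneous_right (by ring) (htd i j))⟩

theorem mem_coboundary₁_of_add_mem (H : IsLiaisonData A B F G m p)
    {a b : Fin 4 → Fin 4 → Frac k} (ha : a ∈ cocycle₁ A) (hb : b ∈ cocycle₁ B)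
    (hz : G • a + F • b ∈ coboundary₁ (liaisonSum A B F G)) :
    a ∈ coboundary₁ A ∧ b ∈ coboundary₁ B := by
  rw [mem_cocycle₁_iff] at ha hb
  simp only [mem_coboundary₁_iff, Pi.add_apply, Pi.smul_apply] at hz ⊢
  obtain ⟨⟨ha, haδ⟩, hb, -⟩ := And.intro ha hb
  obtain ⟨y, hy, hyz⟩ := hz
  choose a' ha' b' hb' hab' _ using fun i =>
    H.exists_smul_add_smul_eq (X_ne_zero i) (isHomogeneous_X k i) 0 (hy i)
  choose c hc hca hcb using fun i j =>
    H.exists_syzygy (mul_ne_zero (X_ne_zero i) (X_ne_zero j))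
      (sectionsOn_le_top _ (Submodule.sub_mem _ (ha i j) (delta₀_mem_sectionsOn ha' i j)))
      (sectionsOn_le_top _ (Submodule.sub_mem _ (hb i j) (delta₀_mem_sectionsOn hb' i j)))
      (by linear_combination (norm := module) -hyz i j - hab' j + hab' i)
  have hcδ : ∀ i j l, c j l - c i l + c i j = 0 := fun i j l => by
    refine H.smul_left_injective ?_
    simp only [smul_sub, smul_add, hca, smul_zero]
    linear_combination haδ i j l
  obtain ⟨d, hd, hdδ⟩ := exists_cochain₀_of_cocycle hc hcδ
  refine ⟨⟨fun i => a' i + F • d i, fun i => ?_, fun i j => ?_⟩,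
    ⟨fun i => b' i - G • d i, fun i => ?_, fun i j => ?_⟩⟩
  · exact Submodule.add_mem _ (ha' i) (smul_mem_sectionsOn_of_mem H.left_mem (hd i))
  · linear_combination (norm := module) hca i j + F • hdδ i j
  · exact Submodule.sub_mem _ (hb' i) (smul_mem_sectionsOn_of_mem H.right_mem (hd i))
  · linear_combination (norm := module) -hcb i j - G • hdδ i j

end IsLiaisonData

end LiaisonAddition

section Multiplication

variable {k : Type*} [Field k] {I J : Ideal (Coord k)} {c : Coord k}

/-- Multiplication by `c`, as a map `Z¹(I) → Z¹(J)` on Čech cocycles. -/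
def cocycleMul (hc : ∀ x ∈ I, c * x ∈ J) : cocycle₁ I →ₗ[Coord k] cocycle₁ J :=
  (LinearMap.lsmul (Coord k) (Fin 4 → Fin 4 → Frac k) c).restrict fun _ hz =>
    ⟨fun i j => smul_mem_sectionsOn hc (hz.1 i j),
      (LinearMap.ker (delta₁ k)).smul_mem c hz.2⟩

/-- Multiplication by `c`, as a map `M(C) → M(C')` on the Hartshorne-Rao modules of the curves
`C` and `C'` defined by `I` and `J`. -/
def hartshorneRaoMul (hc : ∀ x ∈ I, c * x ∈ J) : HartshorneRao I →ₗ[Coord k] HartshorneRao J :=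
  Submodule.mapQ _ _ (cocycleMul hc) <| by
    rintro z ⟨b, hb, hbz⟩
    exact ⟨c • b, fun i => smul_mem_sectionsOn hc (hb i),
      (map_smul (delta₀ k) c b).trans (congrArg (c • ·) hbz)⟩

end Multiplication

section LiaisonMap

variable {k : Type*} [Field k] {A B : Ideal (Coord k)} {F G : Coord k} {m p : ℕ}

/-- The map `M(C_A) ⊕ M(C_B) → M(C)` induced by `(a, b) ↦ G a + F b`. -/
def liaisonMap (A B : Ideal (Coord k)) (F G : Coord k) :
    (HartshorneRao A × HartshorneRao B) →ₗ[Coord k] HartshorneRao (liaisonSum A B F G) :=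
  (hartshorneRaoMul fun _ => mul_mem_liaisonSum_left).coprod
    (hartshorneRaoMul fun _ => mul_mem_liaisonSum_right)

theorem liaisonMap_mk (a : cocycle₁ A) (b : cocycle₁ B) :
    liaisonMap A B F G (Submodule.Quotient.mk a, Submodule.Quotient.mk b) =
      Submodule.Quotient.mk (cocycleMul (fun _ => mul_mem_liaisonSum_left) a +
        cocycleMul (fun _ => mul_mem_liaisonSum_right) b) :=
  rfl

namespace IsLiaisonData

theorem liaisonMap_injective (H : IsLiaisonData A B F G m p) :
    Function.Injective (liaisonMap A B F G) := by
  rw [injective_iff_map_eq_zero]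
  rintro ⟨x, y⟩ hxy
  obtain ⟨a, rfl⟩ := Submodule.Quotient.mk_surjective _ x
  obtain ⟨b, rfl⟩ := Submodule.Quotient.mk_surjective _ y
  rw [liaisonMap_mk, Submodule.Quotient.mk_eq_zero] at hxy
  obtain ⟨ha, hb⟩ := H.mem_coboundary₁_of_add_mem a.2 b.2 hxy
  exact Prod.ext ((Submodule.Quotient.mk_eq_zero _).mpr ha)
    ((Submodule.Quotient.mk_eq_zero _).mpr hb)

theorem exists_liaisonMap_eq (H : IsLiaisonData A B F G m p) (t : ℤ)
    (z : cocycle₁ (liaisonSum A B F G)) :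
    ∃ (a : cocycle₁ A) (b : cocycle₁ B),
      liaisonMap A B F G (Submodule.Quotient.mk a, Submodule.Quotient.mk b) =
        Submodule.Quotient.mk z ∧
      ((∀ i j, z.1 i j ∈ fractionsOfDegree k t) →
        (∀ i j, a.1 i j ∈ fractionsOfDegree k (t - p)) ∧
        ∀ i j, b.1 i j ∈ fractionsOfDegree k (t - m)) := by
  obtain ⟨a, ha, b, hb, hab, hdeg⟩ := H.exists_cocycle₁_add_eq t z.2
  exact ⟨⟨a, ha⟩, ⟨b, hb⟩, congrArg Submodule.Quotient.mk (Subtype.ext hab), hdeg⟩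

theorem liaisonMap_bijective (H : IsLiaisonData A B F G m p) :
    Function.Bijective (liaisonMap A B F G) := by
  refine ⟨H.liaisonMap_injective, fun x => ?_⟩
  obtain ⟨z, rfl⟩ := Submodule.Quotient.mk_surjective _ x
  obtain ⟨a, b, hab, -⟩ := H.exists_liaisonMap_eq 0 z
  exact ⟨_, hab⟩

theorem liaisonMap_mem_iff (H : IsLiaisonData A B F G m p) (t : ℤ)
    (x : HartshorneRao A × HartshorneRao B) :
    liaisonMap A B F G x ∈ hartshorneRaoDegree (liaisonSum A B F G) t ↔
      x ∈ sumGrading (twist (hartshorneRaoDegree A) (-(p : ℤ)))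
        (twist (hartshorneRaoDegree B) (-(m : ℤ))) t := by
  rw [sumGrading, Submodule.mem_prod, twist, twist, neg_add_eq_sub, neg_add_eq_sub]
  constructor
  · rintro ⟨z, hz, hzx⟩
    obtain ⟨a, b, hab, hdeg⟩ := H.exists_liaisonMap_eq t z
    rw [← H.liaisonMap_injective (hab.trans hzx)]
    exact ⟨⟨a, (hdeg hz).1, rfl⟩, ⟨b, (hdeg hz).2, rfl⟩⟩
  · obtain ⟨x, y⟩ := x
    rintro ⟨⟨a, ha, rfl : Submodule.Quotient.mk a = x⟩, b, hb,
      rfl : Submodule.Quotient.mk b = y⟩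
    rw [liaisonMap_mk]
    exact ⟨_, fun i j => Submodule.add_mem _
      (smul_mem_fractionsOfDegree H.isHomogeneous_right (sub_add_cancel _ _) (ha i j))
      (smul_mem_fractionsOfDegree H.isHomogeneous_left (sub_add_cancel _ _) (hb i j)), rfl⟩

theorem gradedIso (H : IsLiaisonData A B F G m p) :
    GradedIso (hartshorneRaoDegree (liaisonSum A B F G))
      (sumGrading (twist (hartshorneRaoDegree A) (-(p : ℤ)))
        (twist (hartshorneRaoDegree B) (-(m : ℤ)))) := by
  let e := LinearEquiv.ofBijective _ H.liaisonMap_bijective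
  refine ⟨e.symm, fun t x => ?_⟩
  rw [← H.liaisonMap_mem_iff]
  change _ ↔ e (e.symm x) ∈ _
  rw [e.apply_symm_apply]

end IsLiaisonData

end LiaisonMap

namespace IsTransverse

attribute [local instance] MvPolynomial.gradedAlgebra

variable {k : Type*} [Field k] [CharZero k] {ι κ : Type*} [Fintype ι] [Fintype κ]
  [Nontrivial ι] {L : ι → Coord k} {M : κ → Coord k}

theorem eq_isolatedPart (h : IsTransverse L M) {Q : Ideal (Coord k)}
    (hQ : IsTopDimensionalPart (jacobianIdeal ((∏ i, L i) * ∏ j, M j)) Q) :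
    Q = isolatedPart (jacobianIdeal ((∏ i, L i) * ∏ j, M j)) := by
  have : Nontrivial (ι ⊕ κ) := Sum.inl_injective.nontrivial
  have hsum := h.isPlaneArrangement_sumElim.eq_isolatedPart (Q := Q)
  simp only [Fintype.prod_sum_type, Sum.elim_inl, Sum.elim_inr] at hsum
  exact hsum hQ

variable [Nontrivial κ]

theorem isLiaisonData (h : IsTransverse L M) {A B : Ideal (Coord k)}
    (hA : A.IsHomogeneous (homogeneousSubmodule (Fin 4) k))
    (hB : B.IsHomogeneous (homogeneousSubmodule (Fin 4) k))
    (hLA : jacobianIdeal (∏ i, L i) ≤ A) (hMB : jacobianIdeal (∏ j, M j) ≤ B) :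
    IsLiaisonData A B (∏ i, L i) (∏ j, M j) (Fintype.card ι) (Fintype.card κ) where
  isHomogeneous_fst := hA
  isHomogeneous_snd := hB
  isHomogeneous_left := h.left.isHomogeneous_prod
  isHomogeneous_right := h.right.isHomogeneous_prod
  left_mem := hLA h.left.prod_mem_jacobianIdeal
  right_mem := hMB h.right.prod_mem_jacobianIdeal
  left_ne_zero := Finset.prod_ne_zero_iff.mpr fun i _ => h.left.ne_zero i
  isRelPrime := h.isRelPrime_prod

theorem gradedIso_isolatedPart (h : IsTransverse L M) :
    GradedIso (hartshorneRaoDegree (isolatedPart (jacobianIdeal ((∏ i, L i) * ∏ j, M j))))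
      (sumGrading
        (twist (hartshorneRaoDegree (isolatedPart (jacobianIdeal (∏ i, L i))))
          (-(Fintype.card κ : ℤ)))
        (twist (hartshorneRaoDegree (isolatedPart (jacobianIdeal (∏ j, M j))))
          (-(Fintype.card ι : ℤ)))) := by
  rw [h.isolatedPart_jacobianIdeal_mul]
  exact (h.isLiaisonData
    (isHomogeneous_isolatedPart (isHomogeneous_jacobianIdeal h.left.isHomogeneous_prod))
    (isHomogeneous_isolatedPart (isHomogeneous_jacobianIdeal h.right.isHomogeneous_prod))
    le_isolatedPart le_isolatedPart).gradedIso

theorem gradedIso_radical (h : IsTransverse L M) :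
    GradedIso (hartshorneRaoDegree (jacobianIdeal ((∏ i, L i) * ∏ j, M j)).radical)
      (sumGrading
        (twist (hartshorneRaoDegree (jacobianIdeal (∏ i, L i)).radical)
          (-(Fintype.card κ : ℤ)))
        (twist (hartshorneRaoDegree (jacobianIdeal (∏ j, M j)).radical)
          (-(Fintype.card ι : ℤ)))) := by
  rw [h.radical_jacobianIdeal_mul]
  exact (h.isLiaisonData
    (isHomogeneous_jacobianIdeal h.left.isHomogeneous_prod).radical
    (isHomogeneous_jacobianIdeal h.right.isHomogeneous_prod).radical
    Ideal.le_radical Ideal.le_radical).gradedIso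

end IsTransverse

end ProductArrangement

end

theorem proposition2p6 {k : Type*} [Field k] [CharZero k] (m p : ℕ) (hm : 2 ≤ m) (hp : 2 ≤ p)
    (L : Fin m → Coord k) (M : Fin p → Coord k)
    (hL : ∀ i, (L i).IsHomogeneous 1) (hM : ∀ j, (M j).IsHomogeneous 1)
    (hLind : Pairwise fun i i' => LinearIndependent k ![L i, L i'])
    (hMind : Pairwise fun j j' => LinearIndependent k ![M j, M j'])
    (F G : Coord k) (hF : F = ∏ i, L i) (hG : G = ∏ j, M j)
    (hGF : ∀ P ∈ (jacobianIdeal F).radical.minimalPrimes, G ∉ P)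
    (hFG : ∀ P ∈ (jacobianIdeal G).radical.minimalPrimes, F ∉ P) :
    (∀ QF QG QFG : Ideal (Coord k),
      IsTopDimensionalPart (jacobianIdeal F) QF →
      IsTopDimensionalPart (jacobianIdeal G) QG →
      IsTopDimensionalPart (jacobianIdeal (F * G)) QFG →
      GradedIso (hartshorneRaoDegree QFG)
        (sumGrading
          (twist (hartshorneRaoDegree QF) (-(p : ℤ)))
          (twist (hartshorneRaoDegree QG) (-(m : ℤ))))) ∧
    GradedIso
      (hartshorneRaoDegree
        (jacobianIdeal (F * G)).radical)
      (sumGrading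
        (twist (hartshorneRaoDegree
          (jacobianIdeal F).radical) (-(p : ℤ)))
        (twist (hartshorneRaoDegree
          (jacobianIdeal G).radical) (-(m : ℤ)))) := by
  subst hF hG
  have : Nontrivial (Fin m) := Fin.nontrivial_iff_two_le.mpr hm
  have : Nontrivial (Fin p) := Fin.nontrivial_iff_two_le.mpr hp
  rw [Ideal.radical_minimalPrimes] at hGF hFG
  have h : IsTransverse L M := ⟨⟨hL, hLind⟩, ⟨hM, hMind⟩, hGF, hFG⟩
  refine ⟨fun QF QG QFG hQF hQG hQFG => ?_, ?_⟩
  · rw [h.left.eq_isolatedPart hQF, h.right.eq_isolatedPart hQG, h.eq_isolatedPart hQFG]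
    simpa only [Fintype.card_fin] using h.gradedIso_isolatedPart
  · simpa only [Fintype.card_fin] using h.gradedIso_radical
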